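/- Let $\alpha,\gamma,\mu>0$, $\beta,\delta\ge 0$ and $\omega>0$, and consider, for $\varepsilon>0$, the forced beam equation $$u_{tt}-\mu u_{ttxx}=-\alpha u_{xxxx}+\beta u_{txx}-\gamma u-\delta u_t+f(u)+\varepsilon h(x,t),\qquad x\in(0,\pi),$$ with hinged ends ($u=u_{xx}=0$ at $x=0,\pi$). Here $f:\mathbb R\to\mathbb R$ is $C^1$, and for some $m>1$ and $C>0$ we have $|f(x)|\le C|x|^m$ and $|f'(x)|\le C|x|^{m-1}$ for all $x$, $f(0)=f'(0)=0$, and $\int_0^x f(\xi)\,d\xi\le 0$ for all $x$; the forcing $h$ is $\omega$-periodic in $t$ and continuously differentiable as a map $\mathbb R\to L^2(0,\pi)$. Let $\mathcal H=H^1_0(0,\pi)\times L^2(0,\pi)$ (real-valued functions, norm $\max(\|u_x\|_{L^2},\|v\|_{L^2})$), let $\mathcal M=1-\mu\partial_x^2$, understood through sine series, let $$A=\begin{pmatrix}0&1\\-\mathcal M^{-1}(\alpha\partial_x^4+\gamma)&\mathcal M^{-1}(\beta\partial_x^2-\delta)\end{pmatrix},$$ and let $e^{tA}$ be the semigroup on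 $\mathcal H$ that acts on the $n$-th sine coefficients of $(u,v)$ as the exponential of $t\begin{pmatrix}0&1\\-\frac{\alpha n^4+\gamma}{1+\mu n^2}&-\frac{\beta n^2+\delta}{1+\mu n^2}\end{pmatrix}$, $n\ge1$. A mild solution of the forced beam equation on a time interval $I$ is a continuous $U=(u,v):I\to\mathcal H$ with $$U(t)=e^{(t-s)A}U(s)+\int_s^t e^{(t-r)A}\bigl(0,\mathcal M^{-1}(f(u(r))+\varepsilon h(r))\bigr)\,dr\qquad(s\le t,\ s,t\in I).$$ The linear forced problem is the same equation with $f=0$. For a base point $\theta\in\mathbb R$, the Poincaré map $P_{\varepsilon,\theta}$ sends $U_0\in\mathcal H$ to $U(\theta+\omega)$, where $U$ is the mild solution on $[\theta,\theta+\omega]$ with $U(\theta)=U_0$; its domain is the set of $U_0$ for which such a solution exists. Assume the non-resonance condition $1\notin\sigma(e^{\omega A})$. Then there are $\rho\ge\varepsilon_0>0$ such that for every $\varepsilon\in(0,\varepsilon_0)$ the following holds. 1. The linear forced problem has a unique $\omega$-periodic mild solution $U_{per}=U_{per}(\cdot\,;\varepsilon)$ on $\mathbb R$. 2. For every $\theta\in\mathbb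 R$, mild solutions of the forced beam equation on $[\theta,\theta+\omega]$ are uniquely determined by their value at $\theta$, and $P_{\varepsilon,\theta}$ is defined on the closed ball of radius $\rho$ about $U_{per}(\theta)$. It has a fixed point in the closed ball of radius $\varepsilon$ about $U_{per}(\theta)$, and this is its only fixed point in the closed ball of radius $\rho$ about $U_{per}(\theta)$. 3. Equivalently, the forced beam equation has an $\omega$-periodic mild solution $U$ on $\mathbb R$ with $\|U(t)-U_{per}(t)\|_{\mathcal H}\le\varepsilon$ for all $t$, and every $\omega$-periodic mild solution $V$ on $\mathbb R$ with $\|V(t)-U_{per}(t)\|_{\mathcal H}\le\rho$ for some $t$ equals $U$. -/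

import Mathlib

open Real MeasureTheory Set Topology
open scoped ENNReal

namespace RayleighBeam

/-- Lebesgue measure on the open interval `(0, π)`. -/
noncomputable abbrev vol : Measure ℝ := volume.restrict (Ioo 0 π)

/-- The real Hilbert space `L²(0, π)`. -/
abbrev L2 : Type := Lp ℝ 2 vol

theorem memLp_of_continuous {g : ℝ → ℝ} (hg : Continuous g) : MemLp g 2 vol := by
  obtain ⟨C, hC⟩ := (isCompact_Icc (a := (0 : ℝ)) (b := π)).exists_bound_of_continuousOn
    hg.continuousOn
  refine MemLp.of_bound hg.aestronglyMeasurable C ?_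
  filter_upwards [ae_restrict_mem measurableSet_Ioo] with x hx
  exact hC x ⟨hx.1.le, hx.2.le⟩

/-- The class in `L²(0, π)` of a continuous function. -/
noncomputable def ofCont (g : ℝ → ℝ) (hg : Continuous g) : L2 := (memLp_of_continuous hg).toLp g

/-- The space `H¹₀(0, π)`. An element `u` is stored as its weak derivative `u_x`; these are exactly
the functions in `L²(0, π)` of mean zero, and `u(x) = ∫₀ˣ u_x` vanishes at `0` and at `π`. The norm
is `‖u_x‖` in `L²(0, π)`. -/
noncomputable abbrev H10 : Submodule ℝ L2 := (ℝ ∙ ofCont (fun _ => 1) continuous_const)ᗮ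

theorem inner_ofCont (g : ℝ → ℝ) (hg : Continuous g) (w : L2) :
    inner ℝ (ofCont g hg) w = ∫ x in Ioo 0 π, w x * g x := by
  rw [L2.inner_def]
  refine integral_congr_ae ?_
  filter_upwards [(memLp_of_continuous hg).coeFn_toLp] with x hx
  simp only [ofCont, hx]
  simp [mul_comm]

theorem mem_H10 (w : L2) : w ∈ H10 ↔ ∫ x in Ioo 0 π, w x = 0 := by
  rw [Submodule.mem_orthogonal_singleton_iff_inner_right, inner_ofCont]
  simp

theorem inner_ofCont_ofCont (g k : ℝ → ℝ) (hg : Continuous g) (hk : Continuous k) :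
    inner ℝ (ofCont g hg) (ofCont k hk) = ∫ x in (0 : ℝ)..π, k x * g x := by
  rw [inner_ofCont, intervalIntegral.integral_of_le pi_pos.le, integral_Ioc_eq_integral_Ioo]
  refine integral_congr_ae ?_
  filter_upwards [(memLp_of_continuous hk).coeFn_toLp] with x hx
  simp only [ofCont, hx]

theorem integral_cos_int (k : ℤ) :
    ∫ x in (0 : ℝ)..π, cos (k * x) = if k = 0 then π else 0 := by
  split_ifs with h
  · simp [h]
  · rw [intervalIntegral.integral_comp_mul_left (fun x => cos x) (by exact_mod_cast h)]
    simp [sin_int_mul_pi]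

/-- `√(2/π) sin((n+1)x)`, `n = 0, 1, 2, …` -/
noncomputable def sineVec (n : ℕ) : L2 :=
  ofCont (fun x => √(2 / π) * sin ((n + 1) * x)) (by fun_prop)

noncomputable def cosVecL2 (n : ℕ) : L2 :=
  ofCont (fun x => √(2 / π) * cos ((n + 1) * x)) (by fun_prop)

theorem cosVecL2_mem (n : ℕ) : cosVecL2 n ∈ H10 := by
  rw [Submodule.mem_orthogonal_singleton_iff_inner_right, cosVecL2, inner_ofCont_ofCont]
  simp only [mul_one]
  rw [intervalIntegral.integral_const_mul]
  have := integral_cos_int (n + 1)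
  rw [if_neg (by omega)] at this
  push_cast at this
  rw [this, mul_zero]

/-- `√(2/π) cos((n+1)x)`, `n = 0, 1, 2, …` -/
noncomputable def cosVec (n : ℕ) : H10 := ⟨cosVecL2 n, cosVecL2_mem n⟩

theorem orthonormal_sineVec : Orthonormal ℝ sineVec := by
  rw [orthonormal_iff_ite]
  intro i j
  rw [sineVec, sineVec, inner_ofCont_ofCont]
  have h1 := integral_cos_int (i - j)
  have h2 := integral_cos_int (i + j + 2)
  rw [if_neg (by omega)] at h2
  have e : ∀ x : ℝ, √(2 / π) * sin ((j + 1) * x) * (√(2 / π) * sin ((i + 1) * x)) =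
      π⁻¹ * (cos (((i - j : ℤ) : ℝ) * x) - cos (((i + j + 2 : ℤ) : ℝ) * x)) := by
    intro x
    have a : ((i - j : ℤ) : ℝ) * x = (i + 1) * x - (j + 1) * x := by push_cast; ring
    have b : ((i + j + 2 : ℤ) : ℝ) * x = (i + 1) * x + (j + 1) * x := by push_cast; ring
    have c : √(2 / π) * √(2 / π) = 2 * π⁻¹ := mul_self_sqrt (by positivity)
    rw [a, b, cos_sub, cos_add]
    linear_combination (sin ((j + 1) * x) * sin ((i + 1) * x)) * c
  simp_rw [e]
  rw [intervalIntegral.integral_const_mul, intervalIntegral.integral_sub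
    (by apply Continuous.intervalIntegrable; fun_prop)
    (by apply Continuous.intervalIntegrable; fun_prop), h1, h2]
  by_cases h : i = j
  · simp [h]
  · rw [if_neg h, if_neg (by omega)]; simp

theorem orthonormal_cosVec : Orthonormal ℝ cosVec := by
  rw [orthonormal_iff_ite]
  intro i j
  change inner ℝ (cosVecL2 i) (cosVecL2 j) = _
  rw [cosVecL2, cosVecL2, inner_ofCont_ofCont]
  have h1 := integral_cos_int (i - j)
  have h2 := integral_cos_int (i + j + 2)
  rw [if_neg (by omega)] at h2
  have e : ∀ x : ℝ, √(2 / π) * cos ((j + 1) * x) * (√(2 / π) * cos ((i + 1) * x)) =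
      π⁻¹ * (cos (((i - j : ℤ) : ℝ) * x) + cos (((i + j + 2 : ℤ) : ℝ) * x)) := by
    intro x
    have a : ((i - j : ℤ) : ℝ) * x = (i + 1) * x - (j + 1) * x := by push_cast; ring
    have b : ((i + j + 2 : ℤ) : ℝ) * x = (i + 1) * x + (j + 1) * x := by push_cast; ring
    have c : √(2 / π) * √(2 / π) = 2 * π⁻¹ := mul_self_sqrt (by positivity)
    rw [a, b, cos_sub, cos_add]
    linear_combination (cos ((j + 1) * x) * cos ((i + 1) * x)) * c
  simp_rw [e]
  rw [intervalIntegral.integral_const_mul, intervalIntegral.integral_add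
    (by apply Continuous.intervalIntegrable; fun_prop)
    (by apply Continuous.intervalIntegrable; fun_prop), h1, h2]
  by_cases h : i = j
  · simp [h]
  · rw [if_neg h, if_neg (by omega)]; simp

theorem L2_integrable (w : L2) : IntegrableOn (fun x => w x) (Ioo 0 π) :=
  (Lp.memLp w).integrable (by norm_num)

theorem integrableOn_mul {G g : ℝ → ℝ} (hG : IntegrableOn G (Ioo 0 π)) (hg : Continuous g) :
    IntegrableOn (fun x => G x * g x) (Ioo 0 π) := by
  obtain ⟨C, hC⟩ := (isCompact_Icc (a := (0 : ℝ)) (b := π)).exists_bound_of_continuousOn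
    hg.continuousOn
  refine Integrable.mul_bdd hG (c := C) hg.aestronglyMeasurable ?_
  filter_upwards [ae_restrict_mem measurableSet_Ioo] with x hx
  exact hC x ⟨hx.1.le, hx.2.le⟩

/-- An integrable function on `(0, π)` all of whose moments against `cos ^ k` vanish is zero. -/
theorem ae_zero_of_moments {G : ℝ → ℝ} (hG : IntegrableOn G (Ioo 0 π))
    (h : ∀ k : ℕ, ∫ x in Ioo 0 π, G x * cos x ^ k = 0) : ∀ᵐ x ∂vol, G x = 0 := by
  have hp : ∀ p : Polynomial ℝ, ∫ x in Ioo 0 π, G x * p.eval (cos x) = 0 := by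
    intro p
    induction p using Polynomial.induction_on' with
    | add p q hp hq =>
      simp only [Polynomial.eval_add, mul_add]
      rw [integral_add (integrableOn_mul hG (by fun_prop)) (integrableOn_mul hG (by fun_prop)),
        hp, hq, add_zero]
    | monomial n a =>
      simp only [Polynomial.eval_monomial]
      have : ∀ x, G x * (a * cos x ^ n) = a * (G x * cos x ^ n) := fun x => by ring
      simp_rw [this]
      rw [integral_const_mul, h, mul_zero]
  let c : C(Icc (0 : ℝ) π, ℝ) := ⟨fun x => cos x, by fun_prop⟩
  have hsep : (Algebra.adjoin ℝ {c}).SeparatesPoints := by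
    intro x y hxy
    refine ⟨c, ⟨c, Algebra.subset_adjoin rfl, rfl⟩, fun hc => hxy ?_⟩
    exact Subtype.ext (injOn_cos x.2 y.2 hc)
  have hdense := ContinuousMap.subalgebra_topologicalClosure_eq_top_of_separatesPoints _ hsep
  have hc : ∀ g : ℝ → ℝ, Continuous g → ∫ x in Ioo 0 π, G x * g x = 0 := by
    intro g hg
    set M := ∫ x in Ioo 0 π, |G x| with hM
    have hM0 : 0 ≤ M := integral_nonneg fun _ => abs_nonneg _
    by_contra hne
    have hpos : 0 < |∫ x in Ioo 0 π, G x * g x| := abs_pos.2 hne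
    set η := |∫ x in Ioo 0 π, G x * g x| / (M + 1) with hη
    have hη0 : 0 < η := by positivity
    let gc : C(Icc (0 : ℝ) π, ℝ) := ⟨fun x => g x, by fun_prop⟩
    have hmem : gc ∈ (Algebra.adjoin ℝ {c}).topologicalClosure := by rw [hdense]; trivial
    obtain ⟨q, hq, hdist⟩ := Metric.mem_closure_iff.1 hmem η hη0
    rw [SetLike.mem_coe, Algebra.adjoin_singleton_eq_range_aeval] at hq
    obtain ⟨p, rfl⟩ := hq
    have hb : ∀ x ∈ Ioo 0 π, |g x - p.eval (cos x)| ≤ η := by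
      intro x hx
      have := (ContinuousMap.dist_le hη0.le).1 hdist.le ⟨x, hx.1.le, hx.2.le⟩
      rw [Real.dist_eq] at this
      have e : ((Polynomial.aeval c p : C(Icc (0 : ℝ) π, ℝ)) ⟨x, hx.1.le, hx.2.le⟩)
          = p.eval (cos x) := by
        rw [Polynomial.aeval_continuousMap_apply]
        simp [c]
      rw [← e]
      exact this
    have e : ∫ x in Ioo 0 π, G x * g x = ∫ x in Ioo 0 π, G x * (g x - p.eval (cos x)) := by
      simp only [mul_sub]
      rw [integral_sub (integrableOn_mul hG hg) (integrableOn_mul hG (by fun_prop)), hp, sub_zero]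
    have : |∫ x in Ioo 0 π, G x * g x| ≤ M * η := by
      rw [e, hM, ← integral_mul_const]
      refine (abs_integral_le_integral_abs).trans ?_
      refine integral_mono_ae (integrableOn_mul hG (by fun_prop)).abs (hG.abs.mul_const _) ?_
      filter_upwards [ae_restrict_mem measurableSet_Ioo] with x hx
      rw [abs_mul]
      exact mul_le_mul_of_nonneg_left (hb x hx) (abs_nonneg _)
    have h2 : |∫ x in Ioo 0 π, G x * g x| = (M + 1) * η := by rw [hη]; field_simp
    nlinarith
  rw [ae_restrict_iff' measurableSet_Ioo]
  refine isOpen_Ioo.ae_eq_zero_of_integral_contDiff_smul_eq_zero hG.locallyIntegrableOn ?_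
  intro g hg _ hsupp
  have h0 : ∫ x in Ioo 0 π, G x * g x = ∫ x, g x • G x := by
    simp only [smul_eq_mul, mul_comm (g _)]
    refine setIntegral_eq_integral_of_forall_compl_eq_zero ?_
    · intro x hx
      have : x ∉ tsupport g := fun h => hx (hsupp h)
      simp [image_eq_zero_of_notMem_tsupport this]
  rw [← h0]
  exact hc g hg.continuous

theorem eq_zero_of_sine (w : L2) (h : ∀ n, inner ℝ (sineVec n) w = 0) : w = 0 := by
  have hw := L2_integrable w
  have hne : √(2 / π) ≠ 0 := by positivity
  have h0 : ∀ n : ℕ, ∫ x in Ioo 0 π, w x * sin (n * x) = 0 := by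
    intro n
    rcases n with _ | n
    · simp
    have := h n
    rw [sineVec, inner_ofCont] at this
    simp_rw [mul_left_comm _ (√(2 / π))] at this
    rw [integral_const_mul] at this
    push_cast
    exact (mul_eq_zero.1 this).resolve_left hne
  have h1 : ∀ n : ℤ, ∫ x in Ioo 0 π, w x * sin (n * x) = 0 := by
    intro n
    obtain ⟨m, rfl | rfl⟩ := n.eq_nat_or_neg
    · simpa using h0 m
    · have := h0 m
      push_cast
      simp_rw [neg_mul, sin_neg, mul_neg]
      rw [integral_neg, this, neg_zero]
  have h2 : ∀ k : ℕ, ∀ n : ℤ, ∫ x in Ioo 0 π, w x * (sin (n * x) * cos x ^ k) = 0 := by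
    intro k
    induction k with
    | zero => intro n; simpa using h1 n
    | succ k ih =>
      intro n
      have e : ∀ x, w x * (sin (n * x) * cos x ^ (k + 1)) =
          2⁻¹ * (w x * (sin ((n + 1 : ℤ) * x) * cos x ^ k) +
            w x * (sin ((n - 1 : ℤ) * x) * cos x ^ k)) := by
        intro x
        push_cast
        rw [add_mul, sub_mul, one_mul, sin_add, sin_sub]
        ring
      simp_rw [e]
      rw [integral_const_mul, integral_add (integrableOn_mul hw (by fun_prop))
        (integrableOn_mul hw (by fun_prop)), ih, ih]
      simp
  have h3 := ae_zero_of_moments (G := fun x => w x * sin x) (integrableOn_mul hw (by fun_prop))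
    (fun k => by simpa [mul_assoc] using h2 k 1)
  refine (Lp.eq_zero_iff_ae_eq_zero).2 ?_
  filter_upwards [h3, ae_restrict_mem measurableSet_Ioo] with x hx hx'
  exact (mul_eq_zero.1 hx).resolve_right (sin_pos_of_mem_Ioo hx').ne'

theorem eq_zero_of_cos (w : H10) (h : ∀ n, inner ℝ (cosVec n) w = 0) : w = 0 := by
  have hw := L2_integrable w.1
  have hne : √(2 / π) ≠ 0 := by positivity
  have h0 : ∀ n : ℕ, ∫ x in Ioo 0 π, w.1 x * cos (n * x) = 0 := by
    intro n
    rcases n with _ | n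
    · simpa using (mem_H10 w.1).1 w.2
    have := h n
    change inner ℝ (cosVecL2 n) w.1 = 0 at this
    rw [cosVecL2, inner_ofCont] at this
    simp_rw [mul_left_comm _ (√(2 / π))] at this
    rw [integral_const_mul] at this
    push_cast
    exact (mul_eq_zero.1 this).resolve_left hne
  have h1 : ∀ n : ℤ, ∫ x in Ioo 0 π, w.1 x * cos (n * x) = 0 := by
    intro n
    obtain ⟨m, rfl | rfl⟩ := n.eq_nat_or_neg
    · simpa using h0 m
    · have := h0 m
      push_cast
      simp_rw [neg_mul, cos_neg]
      exact this
  have h2 : ∀ k : ℕ, ∀ n : ℤ, ∫ x in Ioo 0 π, w.1 x * (cos (n * x) * cos x ^ k) = 0 := by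
    intro k
    induction k with
    | zero => intro n; simpa using h1 n
    | succ k ih =>
      intro n
      have e : ∀ x, w.1 x * (cos (n * x) * cos x ^ (k + 1)) =
          2⁻¹ * (w.1 x * (cos ((n + 1 : ℤ) * x) * cos x ^ k) +
            w.1 x * (cos ((n - 1 : ℤ) * x) * cos x ^ k)) := by
        intro x
        push_cast
        rw [add_mul, sub_mul, one_mul, cos_add, cos_sub]
        ring
      simp_rw [e]
      rw [integral_const_mul, integral_add (integrableOn_mul hw (by fun_prop))
        (integrableOn_mul hw (by fun_prop)), ih, ih]
      simp
  have h3 := ae_zero_of_moments hw (fun k => by simpa using h2 k 0)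
  exact Subtype.ext ((Lp.eq_zero_iff_ae_eq_zero).2 h3)

/-- The sines form a Hilbert basis of `L²(0, π)`. -/
noncomputable def sineBasis : HilbertBasis ℕ ℝ L2 :=
  HilbertBasis.mkOfOrthogonalEqBot orthonormal_sineVec (by
    rw [Submodule.eq_bot_iff]
    intro w hw
    exact eq_zero_of_sine w fun n => hw _ (Submodule.subset_span ⟨n, rfl⟩))

/-- The cosines form a Hilbert basis of the space of derivatives of `H¹₀(0, π)`. -/
noncomputable def cosBasis : HilbertBasis ℕ ℝ H10 :=
  HilbertBasis.mkOfOrthogonalEqBot orthonormal_cosVec (by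
    rw [Submodule.eq_bot_iff]
    intro w hw
    exact eq_zero_of_cos w fun n => hw _ (Submodule.subset_span ⟨n, rfl⟩))

end RayleighBeam

namespace RayleighBeam

/-- Square-summable sequences. -/
abbrev Seq2 : Type := lp (fun _ : ℕ => ℝ) 2

/-- The bounded operator `(ξₙ) ↦ (bₙ ξₙ)` on square-summable sequences, for a bounded sequence `b`. -/
noncomputable def diag (b : ℕ → ℝ) (hb : ∃ C, ∀ n, |b n| ≤ C) : Seq2 →L[ℝ] Seq2 :=
  have key : ∀ C, (∀ n, |b n| ≤ C) → ∀ x : Seq2, ∀ n, ‖b n * x n‖ ≤ ‖(C • x) n‖ := by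
    intro C hC x n
    simp only [lp.coeFn_smul, Pi.smul_apply, smul_eq_mul, norm_mul, Real.norm_eq_abs]
    exact mul_le_mul_of_nonneg_right ((hC n).trans (le_abs_self C)) (abs_nonneg _)
  LinearMap.mkContinuousOfExistsBound
    { toFun := fun x => ⟨fun n => b n * x n,
        hb.elim fun C hC => (lp.memℓp (C • x)).mono' (key C hC x)⟩
      map_add' := fun x y => by ext n; simp [mul_add]; rfl
      map_smul' := fun c x => by ext n; simp [mul_left_comm] }
    (by
      obtain ⟨C, hC⟩ := hb
      refine ⟨|C|, fun x => ?_⟩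
      refine (lp.norm_mono (by norm_num) (key C hC x)).trans ?_
      rw [norm_smul, Real.norm_eq_abs])

/-- Parameters `α`, `β`, `γ`, `δ`, `μ` of the beam. -/
structure Beam where
  α : ℝ
  β : ℝ
  γ : ℝ
  δ : ℝ
  μ : ℝ
  α_pos : 0 < α
  γ_pos : 0 < γ
  μ_pos : 0 < μ
  β_nonneg : 0 ≤ β
  δ_nonneg : 0 ≤ δ

namespace Beam

variable (p : Beam)

/-- Symbol of `M⁻¹ (α ∂⁴ + γ)` on `sin (N x)`, where `M = 1 - μ ∂²` and `N = n + 1`. -/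
noncomputable def stiff (n : ℕ) : ℝ := (p.α * (n + 1) ^ 4 + p.γ) / (1 + p.μ * (n + 1) ^ 2)

/-- Symbol of `-M⁻¹ (β ∂² - δ)` on `sin (N x)`, where `N = n + 1`. -/
noncomputable def damp (n : ℕ) : ℝ := (p.β * (n + 1) ^ 2 + p.δ) / (1 + p.μ * (n + 1) ^ 2)

/-- Symbol of `M⁻¹` on `sin (N x)`, where `N = n + 1`. -/
noncomputable def invMass (n : ℕ) : ℝ := 1 / (1 + p.μ * (n + 1) ^ 2)

/-- Symbol of `A (u, v) = (v, -M⁻¹ (α ∂⁴ + γ) u + M⁻¹ (β ∂² - δ) v)` on `sin (N x)`, acting on the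
pair of `N`-th sine coefficients of `u` and `v`, where `N = n + 1`. -/
noncomputable def mode (n : ℕ) : Matrix (Fin 2) (Fin 2) ℝ := !![0, 1; -p.stiff n, -p.damp n]

/-- The matrix exponential `e ^ (t Aₙ)`. -/
noncomputable def modeExp (t : ℝ) (n : ℕ) : Matrix (Fin 2) (Fin 2) ℝ :=
  NormedSpace.exp (t • p.mode n)

theorem den_pos (n : ℕ) : 0 < 1 + p.μ * ((n : ℝ) + 1) ^ 2 := by
  have := p.μ_pos
  positivity

theorem stiff_pos (n : ℕ) : 0 < p.stiff n := by
  have := p.α_pos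
  have := p.γ_pos
  exact div_pos (by positivity) (p.den_pos n)

theorem damp_nonneg (n : ℕ) : 0 ≤ p.damp n := by
  have := p.β_nonneg
  have := p.δ_nonneg
  exact div_nonneg (by positivity) (p.den_pos n).le

theorem damp_le (n : ℕ) : p.damp n ≤ p.β / p.μ + p.δ := by
  have h1 := p.β_nonneg
  have h2 := p.δ_nonneg
  have h3 := p.μ_pos
  rw [damp, div_le_iff₀ (p.den_pos n), div_add' _ _ _ h3.ne', div_mul_eq_mul_div, le_div_iff₀ h3]
  have : 0 ≤ p.δ * p.μ * (p.μ * ((n : ℝ) + 1) ^ 2) := by positivity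
  nlinarith

theorem stiff_le (n : ℕ) : p.stiff n ≤ (p.α + p.γ) / p.μ * ((n : ℝ) + 1) ^ 2 := by
  have h1 := p.α_pos
  have h2 := p.γ_pos
  have h3 := p.μ_pos
  have hN : (1 : ℝ) ≤ ((n : ℝ) + 1) ^ 4 := one_le_pow₀ (by linarith [n.cast_nonneg (α := ℝ)])
  rw [stiff, div_le_iff₀ (p.den_pos n), div_mul_eq_mul_div, div_mul_eq_mul_div, le_div_iff₀ h3]
  have : 0 ≤ (p.α + p.γ) * ((n : ℝ) + 1) ^ 2 := by positivity
  have := mul_le_mul_of_nonneg_left hN (mul_pos h2 h3).le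
  nlinarith

theorem le_stiff (n : ℕ) : p.α / (1 + p.μ) * ((n : ℝ) + 1) ^ 2 ≤ p.stiff n := by
  have h1 := p.α_pos
  have h2 := p.γ_pos
  have h3 := p.μ_pos
  have hN : (1 : ℝ) ≤ ((n : ℝ) + 1) ^ 2 := one_le_pow₀ (by linarith [n.cast_nonneg (α := ℝ)])
  rw [stiff, le_div_iff₀ (p.den_pos n), div_mul_eq_mul_div, div_mul_eq_mul_div,
    div_le_iff₀ (by positivity)]
  have : 0 ≤ p.α * ((n : ℝ) + 1) ^ 2 := by positivity
  have := mul_le_mul_of_nonneg_left hN this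
  nlinarith [mul_pos h2 h3]

section
attribute [local instance] Matrix.linftyOpNormedRing Matrix.linftyOpNormedAlgebra

theorem hasDerivAt_modeExp (n : ℕ) (t : ℝ) (i j : Fin 2) :
    HasDerivAt (fun s => p.modeExp s n i j) ((p.mode n * p.modeExp t n) i j) t := by
  have h : HasDerivAt (fun s => p.modeExp s n) (p.mode n * p.modeExp t n) t :=
    hasDerivAt_exp_smul_const' (p.mode n) t
  exact ((ContinuousLinearMap.proj (R := ℝ) (φ := fun _ : Fin 2 => ℝ) j).comp
    (ContinuousLinearMap.proj (R := ℝ) (φ := fun _ : Fin 2 => Fin 2 → ℝ) i)).hasFDerivAt.comp_hasDerivAt t h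

end

theorem modeExp_zero (n : ℕ) : p.modeExp 0 n = 1 := by
  simp [modeExp]

/-- The energy of each column of `e ^ (t Aₙ)` grows at most at a rate independent of `n`. -/
theorem energy_le (n : ℕ) (t : ℝ) (j : Fin 2) :
    p.stiff n * p.modeExp t n 0 j ^ 2 + p.modeExp t n 1 j ^ 2 ≤
      exp (2 * (p.β / p.μ + p.δ) * |t|) *
        (p.stiff n * p.modeExp 0 n 0 j ^ 2 + p.modeExp 0 n 1 j ^ 2) := by
  set D := p.β / p.μ + p.δ with hD
  set k := p.stiff n
  set d := p.damp n with hd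
  have hd0 : 0 ≤ d := p.damp_nonneg n
  have hdD : d ≤ D := p.damp_le n
  have hk : 0 < k := p.stiff_pos n
  set e : ℝ → ℝ := fun t => k * p.modeExp t n 0 j ^ 2 + p.modeExp t n 1 j ^ 2 with he
  have hder : ∀ t, HasDerivAt e (-2 * d * p.modeExp t n 1 j ^ 2) t := by
    intro t
    have h0 := p.hasDerivAt_modeExp n t 0 j
    have h1 := p.hasDerivAt_modeExp n t 1 j
    simp only [mode, Matrix.mul_apply, Fin.sum_univ_two, Matrix.of_apply, Matrix.cons_val',
      Matrix.cons_val_zero, Matrix.cons_val_one, Matrix.cons_val_fin_one] at h0 h1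
    have h : HasDerivAt e _ t := ((h0.pow 2).const_mul k).add (h1.pow 2)
    refine h.congr_deriv ?_
    simp only [k, d, Nat.cast_ofNat]
    ring
  change e t ≤ exp (2 * D * |t|) * e 0
  rcases le_total 0 t with ht | ht
  · have hanti : Antitone e := antitone_of_hasDerivAt_nonpos hder fun s => by
      have := mul_nonneg hd0 (sq_nonneg (p.modeExp s n 1 j))
      simp only [Pi.zero_apply]
      nlinarith
    refine (hanti ht).trans ?_
    have h0 : 0 ≤ e 0 := by simp only [he]; positivity
    refine le_mul_of_one_le_left h0 (one_le_exp ?_)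
    have := hd0.trans hdD
    positivity
  · have hmono : Monotone fun s => exp (2 * D * s) * e s := by
      refine monotone_of_hasDerivAt_nonneg (f' := fun s => exp (2 * D * s) * (2 * D) * e s +
        exp (2 * D * s) * (-2 * d * p.modeExp s n 1 j ^ 2)) (fun s => ?_) fun s => ?_
      · have h := ((hasDerivAt_id s).const_mul (2 * D)).exp
        simp only [id, mul_one] at h
        exact h.mul (hder s)
      · have h1 : d * p.modeExp s n 1 j ^ 2 ≤ D * p.modeExp s n 1 j ^ 2 :=
          mul_le_mul_of_nonneg_right hdD (sq_nonneg _)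
        have h2 : 0 ≤ D * (k * p.modeExp s n 0 j ^ 2) :=
          mul_nonneg (hd0.trans hdD) (by positivity)
        have h3 : 0 ≤ 2 * D * e s - 2 * d * p.modeExp s n 1 j ^ 2 := by
          simp only [he]
          nlinarith
        have := mul_nonneg (exp_pos (2 * D * s)).le h3
        simp only [Pi.zero_apply]
        nlinarith
    have h := hmono ht
    simp only [mul_zero, exp_zero, one_mul] at h
    rw [abs_of_nonpos ht, show 2 * D * -t = -(2 * D * t) by ring, exp_neg, ← div_eq_inv_mul,
      le_div_iff₀ (exp_pos _), mul_comm]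
    exact h

theorem bound00 (t : ℝ) : ∃ C, ∀ n, |p.modeExp t n 0 0| ≤ C := by
  refine ⟨√(exp (2 * (p.β / p.μ + p.δ) * |t|)), fun n => abs_le_sqrt ?_⟩
  have h := p.energy_le n t 0
  simp only [modeExp_zero, Matrix.one_apply_eq, Matrix.one_apply_ne (one_ne_zero (α := Fin 2))] at h
  have hk := p.stiff_pos n
  nlinarith [sq_nonneg (p.modeExp t n 1 0)]

theorem bound11 (t : ℝ) : ∃ C, ∀ n, |p.modeExp t n 1 1| ≤ C := by
  refine ⟨√(exp (2 * (p.β / p.μ + p.δ) * |t|)), fun n => abs_le_sqrt ?_⟩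
  have h := p.energy_le n t 1
  simp only [modeExp_zero, Matrix.one_apply_eq, Matrix.one_apply_ne (zero_ne_one (α := Fin 2))] at h
  have := mul_nonneg (p.stiff_pos n).le (sq_nonneg (p.modeExp t n 0 1))
  nlinarith

theorem bound01 (t : ℝ) : ∃ C, ∀ n : ℕ, |((n : ℝ) + 1) * p.modeExp t n 0 1| ≤ C := by
  refine ⟨√(exp (2 * (p.β / p.μ + p.δ) * |t|) * ((1 + p.μ) / p.α)), fun n => abs_le_sqrt ?_⟩
  have h := p.energy_le n t 1
  simp only [modeExp_zero, Matrix.one_apply_eq, Matrix.one_apply_ne (zero_ne_one (α := Fin 2))] at h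
  have h1 := mul_le_mul_of_nonneg_right (p.le_stiff n) (sq_nonneg (p.modeExp t n 0 1))
  have ha := p.α_pos
  have hm := p.μ_pos
  rw [← mul_div_assoc, le_div_iff₀ ha]
  have h2 : p.α / (1 + p.μ) * ((n : ℝ) + 1) ^ 2 * p.modeExp t n 0 1 ^ 2 ≤
      exp (2 * (p.β / p.μ + p.δ) * |t|) := by nlinarith [sq_nonneg (p.modeExp t n 1 1)]
  rw [div_mul_eq_mul_div, div_mul_eq_mul_div, div_le_iff₀ (by positivity)] at h2
  nlinarith

theorem bound10 (t : ℝ) : ∃ C, ∀ n : ℕ, |((n : ℝ) + 1)⁻¹ * p.modeExp t n 1 0| ≤ C := by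
  refine ⟨√(exp (2 * (p.β / p.μ + p.δ) * |t|) * ((p.α + p.γ) / p.μ)), fun n => abs_le_sqrt ?_⟩
  have h := p.energy_le n t 0
  simp only [modeExp_zero, Matrix.one_apply_eq, Matrix.one_apply_ne (one_ne_zero (α := Fin 2))] at h
  have h1 := mul_nonneg (p.stiff_pos n).le (sq_nonneg (p.modeExp t n 0 0))
  have h2 := mul_le_mul_of_nonneg_left (p.stiff_le n) (exp_pos (2 * (p.β / p.μ + p.δ) * |t|)).le
  have hN : (0 : ℝ) < ((n : ℝ) + 1) ^ 2 := by positivity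
  rw [mul_pow, inv_pow, ← div_eq_inv_mul, div_le_iff₀ hN]
  nlinarith

theorem bound_invMass : ∃ C, ∀ n, |p.invMass n| ≤ C := by
  refine ⟨1, fun n => ?_⟩
  have h3 := p.μ_pos
  rw [invMass, abs_of_nonneg (by positivity), div_le_one (by positivity)]
  have : 0 ≤ p.μ * ((n : ℝ) + 1) ^ 2 := by positivity
  linarith

end Beam

/-- The phase space `H¹₀(0, π) × L²(0, π)`. A point `U = (u, v)` is stored as `(u_x, v)`. -/
abbrev Phase : Type := H10 × L2

/-- The displacement `u(x)` of a point `(u, v)` of the phase space. -/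
noncomputable def disp (U : Phase) (x : ℝ) : ℝ := ∫ y in 0..x, U.1.1 y

namespace Beam

variable (p : Beam)

/-- The operator `e ^ (t A)`: it acts on the pair of `N`-th sine coefficients of `u` and `v` by
`e ^ (t Aₙ)`, `N = n + 1`. The `N`-th sine coefficient of `u` is `N⁻¹` times the `N`-th cosine
coefficient of `u_x`, whence the factors `n + 1` and `(n + 1)⁻¹` off the diagonal. -/
noncomputable def semigroup (t : ℝ) : Phase →L[ℝ] Phase :=
  let toU : Phase →L[ℝ] Seq2 :=
    cosBasis.repr.toContinuousLinearEquiv.toContinuousLinearMap ∘L ContinuousLinearMap.fst ℝ H10 L2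
  let toV : Phase →L[ℝ] Seq2 :=
    sineBasis.repr.toContinuousLinearEquiv.toContinuousLinearMap ∘L ContinuousLinearMap.snd ℝ H10 L2
  (cosBasis.repr.symm.toContinuousLinearEquiv.toContinuousLinearMap ∘L
      (diag (fun n => p.modeExp t n 0 0) (p.bound00 t) ∘L toU +
        diag (fun n => (n + 1) * p.modeExp t n 0 1) (p.bound01 t) ∘L toV)).prod
    (sineBasis.repr.symm.toContinuousLinearEquiv.toContinuousLinearMap ∘L
      (diag (fun n => ((n : ℝ) + 1)⁻¹ * p.modeExp t n 1 0) (p.bound10 t) ∘L toU +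
        diag (fun n => p.modeExp t n 1 1) (p.bound11 t) ∘L toV))

/-- The operator `M⁻¹` on `L²(0, π)`. -/
noncomputable def massInv : L2 →L[ℝ] L2 :=
  sineBasis.repr.symm.toContinuousLinearEquiv.toContinuousLinearMap ∘L
    diag p.invMass p.bound_invMass ∘L
      sineBasis.repr.toContinuousLinearEquiv.toContinuousLinearMap

end Beam

theorem memLp_comp_disp (f : C(ℝ, ℝ)) (U : Phase) : MemLp (fun x => f (disp U x)) 2 vol := by
  have hint : IntegrableOn (fun y => U.1.1 y) (uIcc 0 π) := by
    rw [uIcc_of_le pi_pos.le, integrableOn_Icc_iff_integrableOn_Ioo]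
    exact L2_integrable U.1.1
  have hd : ContinuousOn (fun x => f (disp U x)) (Icc 0 π) := by
    have h := intervalIntegral.continuousOn_primitive_interval hint
    rw [uIcc_of_le pi_pos.le] at h
    exact f.continuous.comp_continuousOn h
  obtain ⟨C, hC⟩ := isCompact_Icc.exists_bound_of_continuousOn hd
  refine MemLp.of_bound
    ((hd.mono Ioo_subset_Icc_self).aestronglyMeasurable measurableSet_Ioo) C ?_
  filter_upwards [ae_restrict_mem measurableSet_Ioo] with x hx
  exact hC x ⟨hx.1.le, hx.2.le⟩

/-- The function `f ∘ u` in `L²(0, π)`, for a point `U = (u, v)` of the phase space. -/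
noncomputable def nonlin (f : C(ℝ, ℝ)) (U : Phase) : L2 := (memLp_comp_disp f U).toLp _

/-- `U = (u, v)` is on the interval `I` a mild solution of
`u_tt - μ u_ttxx = -α u_xxxx + β u_txx - γ u - δ u_t + f(u) + g(t)`, that is, of the first order
system `U_t = A U + (0, M⁻¹ (f(u) + g(t)))`. -/
structure IsMildSolution (p : Beam) (f : C(ℝ, ℝ)) (g : ℝ → L2) (I : Set ℝ) (U : ℝ → Phase) :
    Prop where
  continuousOn : ContinuousOn U I
  duhamel : ∀ s ∈ I, ∀ t ∈ I, s ≤ t →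
    U t = p.semigroup (t - s) (U s) +
      ∫ r in s..t, p.semigroup (t - r) (0, p.massInv (nonlin f (U r) + g r))

/-- The period map with base phase `θ`: it sends `U₀` to the value at time `θ + ω` of the mild
solution on `[θ, θ + ω]` that starts at `U₀` at time `θ`. Its domain is the set of those `U₀` for
which such a solution exists. -/
noncomputable def poincareMap (p : Beam) (f : C(ℝ, ℝ)) (g : ℝ → L2) (ω θ : ℝ) : Phase →. Phase :=
  fun U₀ => ⟨∃ U, IsMildSolution p f g (Icc θ (θ + ω)) U ∧ U θ = U₀, fun h => h.choose (θ + ω)⟩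

/-- `U` is an `ω`-periodic mild solution on the whole time axis. -/
structure IsPeriodicSolution (p : Beam) (f : C(ℝ, ℝ)) (g : ℝ → L2) (ω : ℝ) (U : ℝ → Phase) :
    Prop where
  mild : IsMildSolution p f g univ U
  periodic : Function.Periodic U ω

/-- The standing assumptions on the nonlinearity, with growth exponent `m`. -/
structure IsAdmissible (f : C(ℝ, ℝ)) (m : ℝ) : Prop where
  contDiff : ContDiff ℝ 1 f
  growth : ∃ C, ∀ x, |f x| ≤ C * |x| ^ m
  growth_deriv : ∃ C, ∀ x, |deriv f x| ≤ C * |x| ^ (m - 1)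
  zero : f 0 = 0
  deriv_zero : deriv f 0 = 0
  potential : ∀ x, ∫ ξ in 0..x, f ξ ≤ 0

end RayleighBeam

/-!
The semigroup of the linear beam is in fact a strongly continuous *group*: on the sine modes it acts
by the `2 × 2` matrices `e ^ (t Aₙ)`, and the energy estimate bounds them, in the norm of
`H¹₀ × L²`, uniformly in `n` and locally uniformly in `t`, for both signs of `t`
(`Beam.modeExp_bounds`, `Beam.isC0Group_semigroup`). Since `H¹₀(0, π)` embeds into the bounded
functions, `|f'(x)| ≤ C |x| ^ (m - 1)` makes `N(U) = (0, M⁻¹ f(u))` Lipschitz on the ball of radius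
`R` with a constant `O(R ^ (m - 1))`, which tends to `0` with `R` because `m > 1`
(`IsAdmissible.isLipschitzOnBalls`). Everything else is about an abstract equation
`U' = A U + N(U) + ε g(t)` with these two properties.

* Because `A` generates a group, `V(t) = e ^ ((θ - t) A) U(t)` turns mild solutions into solutions
  of an ordinary differential equation whose right hand side is continuous and Lipschitz on balls.
  Uniqueness for the initial value problem (`IsMild.eqOn`) and existence on a whole period for small
  data (`exists_isMild_of_small`) are then the uniqueness and Picard-Lindelöf theorems for such
  equations.
* Non-resonance makes `1 - e ^ (ω A)` invertible, and
  `U(t) = (1 - e ^ (ω A))⁻¹ ∫_{t-ω}^t e ^ ((t - r) A) G(r) dr` is the only periodic mild solution of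
  `U' = A U + G(t)` (`isMild_periodicResponse`, `IsMild.eq_of_periodic`). For `G = ε g` it has size
  `O(ε)`; on a ball of this size `N` is Lipschitz with a small constant, so that the map taking `U`
  to the response to `N(U) + ε g` is a contraction of the ball of radius `ε` about the linear
  response, and its fixed point is the periodic solution (`exists_periodic_isMild`).
* If two solutions in a fixed small ball return to their initial values after one period, their
  difference `D` satisfies `(1 - e ^ (ω A)) D(θ) = O(ℓ) max |D|` and `max |D| = O(|D(θ)|)`, with the
  small Lipschitz constant `ℓ` of `N`; hence `D(θ) = 0` (`IsMild.eq_of_return`). This gives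
  uniqueness in the ball of radius `ρ`, which does not depend on `ε`.
-/

namespace RayleighBeam

open scoped NNReal
open Metric

/-! ### Mild solutions for a strongly continuous group -/

section MildSolutions

variable {X : Type*} [NormedAddCommGroup X] [NormedSpace ℝ X]

/-- `S` is a strongly continuous one-parameter group of bounded operators. Strong continuity is
recorded as joint continuity of `(t, x) ↦ S t x`. -/
structure IsC0Group (S : ℝ → X →L[ℝ] X) : Prop where
  zero : S 0 = 1
  add : ∀ s t, S (s + t) = S s * S t
  continuous : Continuous fun q : ℝ × X => S q.1 q.2

/-- `U` is on `I` a mild solution of `U' = A U + F(t, U)`, where `A` generates `S`. -/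
structure IsMild (S : ℝ → X →L[ℝ] X) (F : ℝ → X → X) (I : Set ℝ) (U : ℝ → X) : Prop where
  continuousOn : ContinuousOn U I
  duhamel : ∀ s ∈ I, ∀ t ∈ I, s ≤ t →
    U t = S (t - s) (U s) + ∫ r in s..t, S (t - r) (F r (U r))

variable {S : ℝ → X →L[ℝ] X}

namespace IsC0Group

theorem apply_apply (hS : IsC0Group S) (s t : ℝ) (x : X) : S s (S t x) = S (s + t) x := by
  rw [hS.add]; rfl

theorem zero_apply (hS : IsC0Group S) (x : X) : S 0 x = x := by
  rw [hS.zero]; rfl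

theorem continuousOn_apply (hS : IsC0Group S) {τ : ℝ → ℝ} {G : ℝ → X} {I : Set ℝ}
    (hτ : ContinuousOn τ I) (hG : ContinuousOn G I) : ContinuousOn (fun r => S (τ r) (G r)) I :=
  hS.continuous.comp_continuousOn (hτ.prodMk hG)

/-- By the uniform boundedness principle a strongly continuous group is bounded on bounded sets of
times. -/
theorem exists_bound [CompleteSpace X] (hS : IsC0Group S) (T : ℝ) :
    ∃ M : ℝ≥0, ∀ t, |t| ≤ T → ‖S t‖ ≤ M := by
  obtain ⟨C, hC⟩ := banach_steinhaus (g := fun t : Icc (-T) T => S t) (by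
    intro x
    obtain ⟨C, hC⟩ := (isCompact_Icc (a := -T) (b := T)).exists_bound_of_continuousOn
      (hS.continuousOn_apply continuousOn_id (continuousOn_const (c := x)))
    exact ⟨C, fun i => hC i i.2⟩)
  exact ⟨C.toNNReal, fun t ht => (hC ⟨t, abs_le.1 ht⟩).trans (le_coe_toNNReal C)⟩

theorem apply_integral [CompleteSpace X] (hS : IsC0Group S) (a b s t : ℝ) {G : ℝ → X}
    (hG : ContinuousOn G (uIcc s t)) :
    S a (∫ r in s..t, S (b - r) (G r)) = ∫ r in s..t, S (a + b - r) (G r) := by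
  rw [← ContinuousLinearMap.intervalIntegral_comp_comm]
  · simp only [hS.apply_apply, add_sub_assoc]
  · exact (hS.continuousOn_apply (by fun_prop) hG).intervalIntegrable

end IsC0Group

/-- The vector field of the interaction picture: `V(t) = S(θ - t) U(t)` turns mild solutions `U`
of `U' = A U + F(t, U)` into solutions `V` of the ordinary differential equation with this right
hand side. -/
def interactionField (S : ℝ → X →L[ℝ] X) (F : ℝ → X → X) (θ : ℝ) (t : ℝ) (x : X) : X :=
  S (θ - t) (F t (S (t - θ) x))

theorem IsC0Group.continuous_interactionField (hS : IsC0Group S) {F : ℝ → X → X}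
    (hF : Continuous fun q : ℝ × X => F q.1 q.2) (θ : ℝ) :
    Continuous fun q : ℝ × X => interactionField S F θ q.1 q.2 := by
  have h1 : Continuous fun q : ℝ × X => S (q.1 - θ) q.2 :=
    hS.continuous.comp (f := fun q : ℝ × X => (q.1 - θ, q.2)) (by fun_prop)
  have h2 : Continuous fun q : ℝ × X => F q.1 (S (q.1 - θ) q.2) :=
    hF.comp (f := fun q : ℝ × X => (q.1, S (q.1 - θ) q.2)) (continuous_fst.prodMk h1)
  exact hS.continuous.comp (f := fun q : ℝ × X => (θ - q.1, F q.1 (S (q.1 - θ) q.2)))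
    ((continuous_const.sub continuous_fst).prodMk h2)

omit [NormedSpace ℝ X] in
theorem continuousOn_comp_curve {F : ℝ → X → X} (hF : Continuous fun q : ℝ × X => F q.1 q.2)
    {I : Set ℝ} {U : ℝ → X} (hU : ContinuousOn U I) : ContinuousOn (fun r => F r (U r)) I :=
  hF.comp_continuousOn (continuousOn_id.prodMk hU)

/-- A mild solution satisfies, in the interaction picture, the integral equation of the ordinary
differential equation. -/
theorem IsMild.eq_picard [CompleteSpace X] (hS : IsC0Group S) {F : ℝ → X → X}
    (hF : Continuous fun q : ℝ × X => F q.1 q.2) {θ T : ℝ} {U : ℝ → X}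
    (hU : IsMild S F (Icc θ T) U) {t : ℝ} (ht : t ∈ Icc θ T) :
    S (θ - t) (U t) =
      ODE.picard (interactionField S F θ) θ (U θ) (fun t => S (θ - t) (U t)) t := by
  have hsub : uIcc θ t ⊆ Icc θ T := by
    rw [uIcc_of_le ht.1]; exact Icc_subset_Icc_right ht.2
  rw [hU.duhamel θ ⟨le_rfl, ht.1.trans ht.2⟩ t ht ht.1, map_add, hS.apply_integral _ _ _ _
    (continuousOn_comp_curve hF (hU.continuousOn.mono hsub)), hS.apply_apply]
  simp only [ODE.picard_apply, interactionField, hS.apply_apply, sub_add_sub_cancel, sub_self,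
    sub_add_cancel, hS.zero_apply]

/-- The converse of `IsMild.eq_picard`. -/
theorem isMild_of_eq_picard [CompleteSpace X] (hS : IsC0Group S) {F : ℝ → X → X}
    (hF : Continuous fun q : ℝ × X => F q.1 q.2) {θ T : ℝ} {V : ℝ → X} {x : X}
    (hV : ContinuousOn V (Icc θ T))
    (hpic : ∀ t ∈ Icc θ T, V t = ODE.picard (interactionField S F θ) θ x V t) :
    IsMild S F (Icc θ T) fun t => S (t - θ) (V t) := by
  have hU : ContinuousOn (fun t => S (t - θ) (V t)) (Icc θ T) :=
    hS.continuousOn_apply (by fun_prop) hV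
  have hG := continuousOn_comp_curve hF hU
  have hc : ContinuousOn (fun r => interactionField S F θ r (V r)) (Icc θ T) :=
    hS.continuousOn_apply (by fun_prop) hG
  refine ⟨hU, fun s hs t ht hst => ?_⟩
  have hint : ∀ a ∈ Icc θ T, ∀ b ∈ Icc θ T,
      IntervalIntegrable (fun r => interactionField S F θ r (V r)) volume a b := fun a ha b hb =>
    (hc.mono (ordConnected_Icc.uIcc_subset ha hb)).intervalIntegrable
  have hθ : θ ∈ Icc θ T := ⟨le_rfl, hs.1.trans hs.2⟩
  have hadd : V t = V s + ∫ r in s..t, interactionField S F θ r (V r) := by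
    rw [hpic t ht, hpic s hs, ODE.picard_apply, ODE.picard_apply, add_assoc,
      intervalIntegral.integral_add_adjacent_intervals (hint θ hθ s hs) (hint s hs t ht)]
  simp only [interactionField] at hadd
  change S (t - θ) (V t) = _
  rw [hadd, map_add, hS.apply_integral _ _ _ _ (hG.mono (ordConnected_Icc.uIcc_subset hs ht)),
    hS.apply_apply, sub_add_sub_cancel, sub_add_cancel]


theorem lipschitzOnWith_interactionField {F : ℝ → X → X}
    {θ t : ℝ} {M K R : ℝ≥0} (hM : ∀ s, |s| ≤ |t - θ| → ‖S s‖ ≤ M)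
    (hF : LipschitzOnWith K (F t) (closedBall 0 (M * R))) :
    LipschitzOnWith (M * (K * M)) (interactionField S F θ t) (closedBall 0 R) := by
  have h1 : LipschitzWith M (S (t - θ)) :=
    (S (t - θ)).lipschitz.weaken (hM _ le_rfl)
  have h2 : LipschitzWith M (S (θ - t)) :=
    (S (θ - t)).lipschitz.weaken (hM _ (abs_sub_comm _ _).le)
  refine h2.comp_lipschitzOnWith (hF.comp h1.lipschitzOnWith fun x hx => ?_)
  rw [mem_closedBall_zero_iff] at hx ⊢
  exact (ContinuousLinearMap.le_of_opNorm_le _ (hM _ le_rfl) x).trans (by gcongr)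

/-- Mild solutions of the initial value problem are unique if `F` is Lipschitz on balls. -/
theorem IsMild.eqOn [CompleteSpace X] (hS : IsC0Group S) {F : ℝ → X → X}
    (hF : Continuous fun q : ℝ × X => F q.1 q.2)
    (hL : ∀ R : ℝ≥0, ∃ K : ℝ≥0, ∀ t, LipschitzOnWith K (F t) (closedBall 0 R)) {θ T : ℝ}
    {U V : ℝ → X} (hU : IsMild S F (Icc θ T) U) (hV : IsMild S F (Icc θ T) V)
    (h0 : U θ = V θ) : EqOn U V (Icc θ T) := by
  have hc : ∀ {U}, IsMild S F (Icc θ T) U → ContinuousOn (fun t => S (θ - t) (U t)) (Icc θ T) :=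
    fun hU => hS.continuousOn_apply (by fun_prop) hU.continuousOn
  have hd : ∀ {U}, IsMild S F (Icc θ T) U → ∀ t ∈ Ico θ T,
      HasDerivWithinAt (fun t => S (θ - t) (U t))
        (interactionField S F θ t (S (θ - t) (U t))) (Ici t) t := by
    intro U hU t ht
    have ht' : t ∈ Icc θ T := ⟨ht.1, ht.2.le⟩
    have h := ODE.hasDerivWithinAt_picard_Icc (f := interactionField S F θ) (u := univ)
      ⟨le_rfl, ht.1.trans ht.2.le⟩
      (hS.continuous_interactionField hF θ).continuousOn (hc hU) (fun _ _ => mem_univ _) (U θ) ht'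
    exact (h.congr (fun s hs => hU.eq_picard hS hF hs) (hU.eq_picard hS hF ht')).mono_of_mem_nhdsWithin
      (Filter.mem_of_superset (Icc_mem_nhdsGE ht.2) (Icc_subset_Icc_left ht.1))
  obtain ⟨M, hM⟩ := hS.exists_bound (T - θ)
  obtain ⟨C₁, hC₁⟩ := isCompact_Icc.exists_bound_of_continuousOn (hc hU)
  obtain ⟨C₂, hC₂⟩ := isCompact_Icc.exists_bound_of_continuousOn (hc hV)
  set R : ℝ≥0 := (max C₁ C₂).toNNReal
  obtain ⟨K, hK⟩ := hL (M * R)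
  have key : EqOn (fun t => S (θ - t) (U t)) (fun t => S (θ - t) (V t)) (Icc θ T) := by
    refine ODE_solution_unique_of_mem_Icc_right (v := interactionField S F θ)
      (s := fun _ => closedBall 0 R) (K := M * (K * M)) (fun t ht => ?_) (hc hU) (hd hU)
      (fun t ht => ?_) (hc hV) (hd hV) (fun t ht => ?_) (by simp [h0])
    · refine lipschitzOnWith_interactionField (fun s hs => hM s (hs.trans ?_))
        (by simpa using hK t)
      rw [abs_of_nonneg (by linarith [ht.1])]
      linarith [ht.2]
    · rw [mem_closedBall_zero_iff]
      exact (hC₁ t ⟨ht.1, ht.2.le⟩).trans ((le_max_left _ _).trans (Real.le_coe_toNNReal _))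
    · rw [mem_closedBall_zero_iff]
      exact (hC₂ t ⟨ht.1, ht.2.le⟩).trans ((le_max_right _ _).trans (Real.le_coe_toNNReal _))
  intro t ht
  have h := congrArg (S (t - θ)) (key ht)
  simpa only [hS.apply_apply, sub_add_sub_cancel, sub_self, hS.zero_apply] using h

/-- For small data a mild solution exists on a whole prescribed interval, and it stays in the ball
on which the size and the Lipschitz constant of `F` are controlled. -/
theorem exists_isMild_of_small [CompleteSpace X] (hS : IsC0Group S) {F : ℝ → X → X}
    (hF : Continuous fun q : ℝ × X => F q.1 q.2) {θ ω : ℝ} (hω : 0 ≤ ω) {M K R r B : ℝ≥0}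
    (hM0 : 0 < M) (hM : ∀ t, |t| ≤ ω → ‖S t‖ ≤ M)
    (hK : ∀ t, LipschitzOnWith K (F t) (closedBall 0 R))
    (hB : ∀ t, ∀ x ∈ closedBall (0 : X) R, ‖F t x‖ ≤ B)
    (hsmall : M * B * ω ≤ R / M - r) {x : X} (hx : ‖x‖ ≤ r) :
    ∃ U, IsMild S F (Icc θ (θ + ω)) U ∧ U θ = x ∧ ∀ t ∈ Icc θ (θ + ω), ‖U t‖ ≤ R := by
  have hMR : M * (R / M) = R := mul_div_cancel₀ R hM0.ne'
  have habs : ∀ t ∈ Icc θ (θ + ω), |t - θ| ≤ ω := fun t ht => by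
    rw [abs_of_nonneg (by linarith [ht.1])]; linarith [ht.2]
  have hball : ∀ t ∈ Icc θ (θ + ω), ∀ y ∈ closedBall (0 : X) (R / M : ℝ≥0),
      S (t - θ) y ∈ closedBall (0 : X) R := fun t ht y hy => by
    rw [mem_closedBall_zero_iff] at hy ⊢
    refine (ContinuousLinearMap.le_of_opNorm_le _ (hM _ (habs t ht)) y).trans ?_
    rw [← hMR]
    push_cast at hy ⊢
    gcongr
  have hmem : θ ∈ Icc θ (θ + ω) := ⟨le_rfl, by linarith⟩
  have hPL : IsPicardLindelof (interactionField S F θ) (tmin := θ) (tmax := θ + ω) ⟨θ, hmem⟩ 0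
      (R / M) r (M * B) (M * (K * M)) := by
    refine ⟨fun t ht => ?_, fun y _ => ?_, fun t ht y hy => ?_, ?_⟩
    · refine lipschitzOnWith_interactionField (fun s hs => hM s (hs.trans (habs t ht))) ?_
      have := hK t
      rwa [← hMR, NNReal.coe_mul] at this
    · exact ((hS.continuous_interactionField hF θ).comp (f := fun t => (t, y))
        (by fun_prop)).continuousOn
    · rw [NNReal.coe_mul]
      refine (ContinuousLinearMap.le_of_opNorm_le _ (hM _ ?_) _).trans ?_
      · rw [abs_sub_comm]; exact habs t ht
      · gcongr
        exact hB t _ (hball t ht y hy)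
    · simp only [add_sub_cancel_left, sub_self, max_eq_left hω]
      push_cast
      exact hsmall
  have hx' : x ∈ closedBall (0 : X) r := by rwa [mem_closedBall_zero_iff]
  obtain ⟨v, hv⟩ := ODE.FunSpace.exists_isFixedPt_next hPL hx'
  have hpic := (ODE.FunSpace.isFixedPt_next_iff hPL hx').1 hv
  have hvt : ∀ t (ht : t ∈ Icc θ (θ + ω)),
      v.compProj t = ODE.picard (interactionField S F θ) θ x v.compProj t := fun t ht => by
    rw [v.compProj_of_mem ht]; exact hpic ⟨t, ht⟩
  refine ⟨_, isMild_of_eq_picard hS hF v.continuous_compProj.continuousOn hvt, ?_, fun t ht => ?_⟩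
  · rw [sub_self, hS.zero_apply, hvt θ hmem, ODE.picard_apply₀]
  · rw [← mem_closedBall_zero_iff]
    exact hball t ht _ (v.compProj_mem_closedBall hPL.mul_max_le)

end MildSolutions

/-! ### Periodic solutions of linear and nonlinear equations -/

section PeriodicResponse

variable {X : Type*} [NormedAddCommGroup X] [NormedSpace ℝ X] {S : ℝ → X →L[ℝ] X}

/-- The `ω`-periodic mild solution of `U' = A U + G(t)` for an `ω`-periodic forcing `G`, where `R`
is the inverse of `1 - S ω`. -/
noncomputable def periodicResponse (S : ℝ → X →L[ℝ] X) (R : X →L[ℝ] X) (ω : ℝ) (G : ℝ → X)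
    (t : ℝ) : X :=
  R (∫ r in (t - ω)..t, S (t - r) (G r))

theorem IsC0Group.continuous_apply (hS : IsC0Group S) {τ : ℝ → ℝ} {G : ℝ → X}
    (hτ : Continuous τ) (hG : Continuous G) : Continuous fun r => S (τ r) (G r) :=
  hS.continuous.comp (hτ.prodMk hG)

theorem continuous_periodicResponse [CompleteSpace X] (hS : IsC0Group S) (R : X →L[ℝ] X) (ω : ℝ)
    {G : ℝ → X} (hG : Continuous G) : Continuous (periodicResponse S R ω G) := by
  -- `S t` is moved out of the integral, whose integrand then does not depend on `t`
  have h : ∀ t, periodicResponse S R ω G t =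
      R (S t ((∫ r in 0..t, S (0 - r) (G r)) - ∫ r in 0..(t - ω), S (0 - r) (G r))) := by
    intro t
    have hi : ∀ a b, IntervalIntegrable (fun r => S (0 - r) (G r)) volume a b := fun a b =>
      (hS.continuous_apply (by fun_prop) hG).intervalIntegrable a b
    rw [intervalIntegral.integral_interval_sub_left (hi _ _) (hi _ _),
      hS.apply_integral _ _ _ _ hG.continuousOn, add_zero, periodicResponse]
  rw [funext h]
  have hp : Continuous fun t => ∫ r in 0..t, S (0 - r) (G r) :=
    intervalIntegral.continuous_primitive
      (fun a b => (hS.continuous_apply (by fun_prop) hG).intervalIntegrable a b) 0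
  exact R.continuous.comp (hS.continuous_apply continuous_id
    (hp.sub (hp.comp (continuous_id.sub continuous_const))))

theorem periodic_periodicResponse (R : X →L[ℝ] X) {ω : ℝ} {G : ℝ → X}
    (hG : Function.Periodic G ω) : Function.Periodic (periodicResponse S R ω G) ω := by
  intro t
  have h := intervalIntegral.integral_comp_add_right (a := t - ω) (b := t)
    (fun r => S (t + ω - r) (G r)) ω
  simp only [hG _, add_sub_add_right_eq_sub] at h
  rw [periodicResponse, periodicResponse, h, sub_add_cancel, add_sub_cancel_right]

/-- The Duhamel formula: the integrals over `[t - ω, t]` and `[s - ω, s]` differ by the integrals over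
`[s, t]` and `[s - ω, t - ω]`, and by periodicity the latter is `S ω` applied to the former. -/
theorem periodicResponse_duhamel [CompleteSpace X] (hS : IsC0Group S) {R : X →L[ℝ] X} {ω : ℝ}
    (hR₁ : R * (1 - S ω) = 1) (hR₂ : (1 - S ω) * R = 1) {G : ℝ → X} (hG : Continuous G)
    (hper : Function.Periodic G ω) (s t : ℝ) :
    periodicResponse S R ω G t = S (t - s) (periodicResponse S R ω G s) +
      ∫ r in s..t, S (t - r) (G r) := by
  have hcomm : S (t - s) * R = R * S (t - s) := by
    have h : (1 - S ω) * S (t - s) = S (t - s) * (1 - S ω) := by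
      rw [sub_mul, mul_sub, one_mul, mul_one, ← hS.add, ← hS.add, add_comm]
    calc S (t - s) * R = R * ((1 - S ω) * S (t - s)) * R := by rw [← mul_assoc, hR₁, one_mul]
      _ = R * S (t - s) * ((1 - S ω) * R) := by rw [h]; simp only [mul_assoc]
      _ = R * S (t - s) := by rw [hR₂, mul_one]
  have hi : ∀ a b, IntervalIntegrable (fun r => S (t - r) (G r)) volume a b := fun a b =>
    (hS.continuous_apply (by fun_prop) hG).intervalIntegrable a b
  have hshift : ∫ r in (s - ω)..(t - ω), S (t - r) (G r) =
      S ω (∫ r in s..t, S (t - r) (G r)) := by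
    rw [hS.apply_integral _ _ _ _ hG.continuousOn, ← intervalIntegral.integral_comp_sub_right]
    refine intervalIntegral.integral_congr fun r _ => ?_
    rw [hper.sub_eq, show t - (r - ω) = ω + t - r by ring]
  have hdiff : (∫ r in (t - ω)..t, S (t - r) (G r)) - ∫ r in (s - ω)..s, S (t - r) (G r) =
      (1 - S ω) (∫ r in s..t, S (t - r) (G r)) := by
    rw [intervalIntegral.integral_interval_sub_interval_comm (hi _ _) (hi _ _) (hi _ _),
      intervalIntegral.integral_symm (s - ω) (t - ω), intervalIntegral.integral_symm s t, hshift]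
    simp only [sub_apply, one_apply_eq_self]
    abel
  have h1 : S (t - s) (periodicResponse S R ω G s) =
      R (∫ r in (s - ω)..s, S (t - r) (G r)) := by
    have := congrArg (fun A : X →L[ℝ] X => A (∫ r in (s - ω)..s, S (s - r) (G r))) hcomm
    simp only [mul_apply_eq_comp] at this
    rw [periodicResponse, this, hS.apply_integral _ _ _ _ hG.continuousOn, sub_add_cancel]
  have h2 : R ((1 - S ω) (∫ r in s..t, S (t - r) (G r))) = ∫ r in s..t, S (t - r) (G r) := by
    rw [← mul_apply_eq_comp, hR₁]; rfl
  rw [h1, ← h2, ← hdiff, map_sub, periodicResponse, add_sub_cancel]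

theorem isMild_periodicResponse [CompleteSpace X] (hS : IsC0Group S) {R : X →L[ℝ] X} {ω : ℝ}
    (hR₁ : R * (1 - S ω) = 1) (hR₂ : (1 - S ω) * R = 1) {G : ℝ → X} (hG : Continuous G)
    (hper : Function.Periodic G ω) :
    IsMild S (fun r _ => G r) univ (periodicResponse S R ω G) :=
  ⟨(continuous_periodicResponse hS R ω hG).continuousOn, fun s _ t _ _ =>
    periodicResponse_duhamel hS hR₁ hR₂ hG hper s t⟩

/-- Without resonance there is at most one periodic solution of the linear problem: the difference
`D` of two of them satisfies `D = S ω D`. -/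
theorem IsMild.eq_of_periodic {R : X →L[ℝ] X} {ω : ℝ} (hω : 0 ≤ ω) (hR : R * (1 - S ω) = 1)
    {G : ℝ → X} {U V : ℝ → X} (hU : IsMild S (fun r _ => G r) univ U)
    (hUp : Function.Periodic U ω) (hV : IsMild S (fun r _ => G r) univ V)
    (hVp : Function.Periodic V ω) : U = V := by
  funext t
  have h1 := hU.duhamel t (mem_univ _) (t + ω) (mem_univ _) (by linarith)
  have h2 := hV.duhamel t (mem_univ _) (t + ω) (mem_univ _) (by linarith)
  rw [hUp, add_sub_cancel_left] at h1
  rw [hVp, add_sub_cancel_left] at h2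
  have h3 : (1 - S ω) (U t - V t) = 0 := by
    rw [sub_apply, one_apply_eq_self, map_sub]
    nth_rewrite 1 [h1, h2]
    abel
  have h4 := congrArg R h3
  rw [← mul_apply_eq_comp, hR, map_zero] at h4
  exact sub_eq_zero.1 h4

theorem norm_periodicResponse_le {R : X →L[ℝ] X} {ω k M c : ℝ} (hω : 0 ≤ ω) (hk : ‖R‖ ≤ k)
    (hM : ∀ t, |t| ≤ ω → ‖S t‖ ≤ M) {G : ℝ → X} (hG : ∀ r, ‖G r‖ ≤ c) (t : ℝ) :
    ‖periodicResponse S R ω G t‖ ≤ k * (M * c * ω) := by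
  have hk0 : 0 ≤ k := (norm_nonneg _).trans hk
  refine (R.le_of_opNorm_le hk _).trans ?_
  gcongr
  have h := intervalIntegral.norm_integral_le_of_norm_le_const (a := t - ω) (b := t) (C := M * c)
    (f := fun r => S (t - r) (G r)) fun r hr => by
      rw [uIoc_of_le (by linarith)] at hr
      have hM' := hM (t - r) (by rw [abs_of_nonneg (by linarith [hr.2])]; linarith [hr.1])
      have hM0 := (norm_nonneg _).trans hM'
      exact ((S (t - r)).le_of_opNorm_le hM' _).trans (by gcongr; exact hG r)
  rwa [sub_sub_cancel, abs_of_nonneg hω] at h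

theorem periodicResponse_sub (hS : IsC0Group S) (R : X →L[ℝ] X) (ω : ℝ) {G H : ℝ → X}
    (hG : Continuous G) (hH : Continuous H) (t : ℝ) :
    periodicResponse S R ω G t - periodicResponse S R ω H t =
      periodicResponse S R ω (fun r => G r - H r) t := by
  have hi : ∀ {G : ℝ → X}, Continuous G → ∀ a b,
      IntervalIntegrable (fun r => S (t - r) (G r)) volume a b := fun hG a b =>
    (hS.continuous_apply (by fun_prop) hG).intervalIntegrable a b
  simp only [periodicResponse, map_sub]
  rw [← map_sub, intervalIntegral.integral_sub (hi hG _ _) (hi hH _ _)]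

end PeriodicResponse

section Nonlinear

variable {X : Type*} [NormedAddCommGroup X] [NormedSpace ℝ X]

/-- `N` vanishes at the origin and is Lipschitz with constant `ℓ R` on the ball of radius `R`. -/
structure IsLipschitzOnBalls (N : X → X) (ℓ : ℝ≥0 → ℝ≥0) : Prop where
  zero : N 0 = 0
  lipschitzOnWith : ∀ R : ℝ≥0, LipschitzOnWith (ℓ R) N (closedBall 0 R)

namespace IsLipschitzOnBalls

variable {N : X → X} {ℓ : ℝ≥0 → ℝ≥0}

omit [NormedSpace ℝ X] in
theorem continuous (hN : IsLipschitzOnBalls N ℓ) : Continuous N := by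
  rw [continuous_iff_continuousAt]
  intro x
  refine (hN.lipschitzOnWith (‖x‖₊ + 1)).continuousOn.continuousAt ?_
  refine Filter.mem_of_superset (isOpen_ball.mem_nhds (?_ : x ∈ ball 0 (‖x‖₊ + 1 : ℝ≥0)))
    ball_subset_closedBall
  simp

omit [NormedSpace ℝ X] in
theorem norm_sub_le (hN : IsLipschitzOnBalls N ℓ) {R : ℝ≥0} {x y : X} (hx : ‖x‖ ≤ R)
    (hy : ‖y‖ ≤ R) : ‖N x - N y‖ ≤ ℓ R * ‖x - y‖ :=
  (hN.lipschitzOnWith R).norm_sub_le (by simpa using hx) (by simpa using hy)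

omit [NormedSpace ℝ X] in
theorem norm_le (hN : IsLipschitzOnBalls N ℓ) {R : ℝ≥0} {x : X} (hx : ‖x‖ ≤ R) :
    ‖N x‖ ≤ ℓ R * ‖x‖ := by
  simpa [hN.zero] using hN.norm_sub_le hx (y := 0) (by simp)

end IsLipschitzOnBalls

variable {S : ℝ → X →L[ℝ] X}

/-- A nonlinear periodic solution near the periodic solution of the linear problem, as the fixed
point of `U ↦ periodicResponse (N ∘ U + g)` among the bounded continuous periodic functions. -/
theorem exists_periodic_isMild [CompleteSpace X] (hS : IsC0Group S) {R : X →L[ℝ] X} {ω : ℝ}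
    (hω : 0 ≤ ω) (hR₁ : R * (1 - S ω) = 1) (hR₂ : (1 - S ω) * R = 1) {N : X → X} {ℓ : ℝ≥0 → ℝ≥0}
    (hN : IsLipschitzOnBalls N ℓ) {g : ℝ → X} (hg : Continuous g) (hper : Function.Periodic g ω)
    {k M c w e : ℝ} {ϱ : ℝ≥0} (hc : ∀ t, ‖g t‖ ≤ c) (hk : ‖R‖ ≤ k)
    (hM : ∀ t, |t| ≤ ω → ‖S t‖ ≤ M) (he : 0 ≤ e)
    (hw : ∀ t, ‖periodicResponse S R ω g t‖ ≤ w) (hwe : w + e ≤ ϱ)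
    (hq : k * (M * ℓ ϱ * ω) ≤ 1 / 2) (hqe : k * (M * ℓ ϱ * ω) * (w + e) ≤ e) :
    ∃ U : ℝ → X, IsMild S (fun r x => N x + g r) univ U ∧ Function.Periodic U ω ∧
      ∀ t, dist (U t) (periodicResponse S R ω g t) ≤ e := by
  have hNc := hN.continuous
  have hNU : ∀ U : BoundedContinuousFunction ℝ X, Continuous fun r => N (U r) + g r := fun U =>
    (hNc.comp U.continuous).add hg
  let Ψ : BoundedContinuousFunction ℝ X → BoundedContinuousFunction ℝ X := fun U =>
    BoundedContinuousFunction.ofNormedAddCommGroup (periodicResponse S R ω fun r => N (U r) + g r)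
      (continuous_periodicResponse hS R ω (hNU U)) (k * (M * (ℓ ‖U‖₊ * ‖U‖ + c) * ω))
      (norm_periodicResponse_le hω hk hM fun r => (norm_add_le _ _).trans (add_le_add
        ((hN.norm_le (R := ‖U‖₊) (U.norm_coe_le_norm r)).trans
          (by gcongr; exact U.norm_coe_le_norm r)) (hc r)))
  let W : BoundedContinuousFunction ℝ X := Ψ 0
  have hW : ∀ t, W t = periodicResponse S R ω g t := fun t => by
    change periodicResponse S R ω (fun r => N 0 + g r) t = _
    simp only [hN.zero, zero_add]
  let s : Set (BoundedContinuousFunction ℝ X) := closedBall W e ∩ {U | Function.Periodic U ω}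
  have hsc : IsClosed s := by
    refine isClosed_closedBall.inter ?_
    have : {U : BoundedContinuousFunction ℝ X | Function.Periodic U ω} =
        ⋂ t, {U | U (t + ω) = U t} := by
      ext U; simp [Function.Periodic]
    rw [this]
    exact isClosed_iInter fun t => isClosed_eq
      (continuous_eval_const (t + ω))
      (continuous_eval_const t)
  have hsb : ∀ U ∈ s, ∀ t, ‖U t‖ ≤ w + e := fun U hU t => by
    have h1 := (BoundedContinuousFunction.dist_coe_le_dist t).trans (mem_closedBall.1 hU.1)
    rw [hW, dist_eq_norm] at h1
    have h2 := norm_le_norm_add_norm_sub' (U t) (periodicResponse S R ω g t)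
    linarith [hw t]
  have hdiff : ∀ (U V : BoundedContinuousFunction ℝ X) (d : ℝ), (∀ t, ‖U t‖ ≤ ϱ) →
      (∀ t, ‖V t‖ ≤ ϱ) → (∀ t, ‖U t - V t‖ ≤ d) → ∀ t, dist (Ψ U t) (Ψ V t) ≤
        k * (M * ℓ ϱ * ω) * d := by
    intro U V d hU hV hd t
    change dist (periodicResponse S R ω _ t) (periodicResponse S R ω _ t) ≤ _
    rw [dist_eq_norm, periodicResponse_sub hS R ω (hNU U) (hNU V)]
    refine (norm_periodicResponse_le (c := ℓ ϱ * d) hω hk hM (fun r => ?_) t).trans_eq (by ring)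
    rw [add_sub_add_right_eq_sub]
    exact (hN.norm_sub_le (hU r) (hV r)).trans (by gcongr; exact hd r)
  have hmaps : MapsTo Ψ s s := by
    intro U hU
    refine ⟨?_, ?_⟩
    · rw [mem_closedBall, BoundedContinuousFunction.dist_le he]
      intro t
      refine (hdiff U 0 (w + e) (fun t => (hsb U hU t).trans hwe) (fun t => by simp)
        (fun t => by simpa using hsb U hU t) t).trans hqe
    · refine periodic_periodicResponse R fun t => ?_
      simp only [hU.2 t, hper t]
  have hcontr : ContractingWith (1 / 2) (hmaps.restrict Ψ s s) := by
    refine ⟨by norm_num, LipschitzWith.of_dist_le_mul fun U V => ?_⟩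
    change dist (Ψ U.1) (Ψ V.1) ≤ _ * dist U.1 V.1
    rw [BoundedContinuousFunction.dist_le (by positivity)]
    intro t
    refine (hdiff U V (dist U.1 V.1) (fun t => (hsb U U.2 t).trans hwe)
      (fun t => (hsb V V.2 t).trans hwe) (fun t => ?_) t).trans ?_
    · rw [← dist_eq_norm]; exact BoundedContinuousFunction.dist_coe_le_dist t
    · gcongr
      simpa using hq
  have hWs : W ∈ s := ⟨mem_closedBall_self he, by
    have : (W : ℝ → X) = periodicResponse S R ω g := funext hW
    rw [mem_ofPred_eq, this]
    exact periodic_periodicResponse R hper⟩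
  obtain ⟨U, hUs, hU, -⟩ := hcontr.exists_fixedPoint' hsc.isComplete hmaps hWs (edist_ne_top _ _)
  have hUeq : ∀ t, U t = periodicResponse S R ω (fun r => N (U r) + g r) t := fun t =>
    congrArg (fun V : BoundedContinuousFunction ℝ X => V t) (Function.IsFixedPt.eq hU).symm
  refine ⟨U, ⟨U.continuous.continuousOn, fun s _ t _ _ => ?_⟩, hUs.2, fun t => ?_⟩
  · rw [hUeq t, hUeq s]
    exact periodicResponse_duhamel hS hR₁ hR₂ (hNU U) (fun t => by simp only [hUs.2 t, hper t]) s t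
  · rw [← hW]
    exact (BoundedContinuousFunction.dist_coe_le_dist t).trans (mem_closedBall.1 hUs.1)

end Nonlinear

/-! ### Uniqueness of periodic solutions in a ball -/

section FixedPoints

variable {X : Type*} [NormedAddCommGroup X] [NormedSpace ℝ X] {S : ℝ → X →L[ℝ] X}

/-- Two solutions in a ball of small Lipschitz constant that return to their initial values have
the same initial value: their difference `D` satisfies `(1 - S ω) D(θ) = I` with `I` small compared
with the maximum of `D`, and this maximum is at most a multiple of `D(θ)`. -/
theorem IsMild.eq_of_return (hS : IsC0Group S) {R : X →L[ℝ] X} {θ ω : ℝ} (hω : 0 ≤ ω)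
    (hR : R * (1 - S ω) = 1) {N : X → X} {ℓ : ℝ≥0 → ℝ≥0} (hN : IsLipschitzOnBalls N ℓ)
    {g : ℝ → X} (hg : Continuous g) {k M : ℝ} {ϱ : ℝ≥0} (hk : ‖R‖ ≤ k)
    (hM : ∀ t, |t| ≤ ω → ‖S t‖ ≤ M) (hq : M * ℓ ϱ * ω ≤ 1 / 2)
    (hqk : k * (M * ℓ ϱ * ω) * (2 * M) < 1) {U V : ℝ → X}
    (hU : IsMild S (fun r x => N x + g r) (Icc θ (θ + ω)) U)
    (hV : IsMild S (fun r x => N x + g r) (Icc θ (θ + ω)) V)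
    (hUb : ∀ t ∈ Icc θ (θ + ω), ‖U t‖ ≤ ϱ) (hVb : ∀ t ∈ Icc θ (θ + ω), ‖V t‖ ≤ ϱ)
    (hUr : U (θ + ω) = U θ) (hVr : V (θ + ω) = V θ) : U θ = V θ := by
  have hθ : θ ∈ Icc θ (θ + ω) := ⟨le_rfl, by linarith⟩
  have hθω : θ + ω ∈ Icc θ (θ + ω) := ⟨by linarith, le_rfl⟩
  have hM0 : 0 ≤ M := (norm_nonneg _).trans (hM 0 (by simpa using hω))
  have hk0 : 0 ≤ k := (norm_nonneg _).trans hk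
  obtain ⟨τ, hτ, hmax⟩ := isCompact_Icc.exists_isMaxOn ⟨θ, hθ⟩
    (hU.continuousOn.sub hV.continuousOn).norm
  set m := ‖U τ - V τ‖ with hm
  have hmax' : ∀ t ∈ Icc θ (θ + ω), ‖U t - V t‖ ≤ m := fun t ht => hmax ht
  have hcont : ∀ {U : ℝ → X}, ContinuousOn U (Icc θ (θ + ω)) → ∀ t ∈ Icc θ (θ + ω),
      IntervalIntegrable (fun r => S (t - r) (N (U r) + g r)) volume θ t := fun hU t ht =>
    ((hS.continuousOn_apply (by fun_prop)
      ((hN.continuous.comp_continuousOn hU).add hg.continuousOn)).mono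
        (ordConnected_Icc.uIcc_subset hθ ht)).intervalIntegrable
  -- the Duhamel formula for the difference, in which the forcing cancels
  have hduh : ∀ t ∈ Icc θ (θ + ω), ‖U t - V t - S (t - θ) (U θ - V θ)‖ ≤ M * ℓ ϱ * ω * m := by
    intro t ht
    have e : U t - V t - S (t - θ) (U θ - V θ) = ∫ r in θ..t, S (t - r) (N (U r) - N (V r)) := by
      rw [hU.duhamel θ hθ t ht ht.1, hV.duhamel θ hθ t ht ht.1, add_sub_add_comm,
        ← intervalIntegral.integral_sub (hcont hU.continuousOn t ht) (hcont hV.continuousOn t ht),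
        map_sub, add_sub_cancel_left]
      simp only [← map_sub, add_sub_add_right_eq_sub]
    rw [e]
    have h := intervalIntegral.norm_integral_le_of_norm_le_const (a := θ) (b := t)
      (C := M * (ℓ ϱ * m)) (f := fun r => S (t - r) (N (U r) - N (V r))) fun r hr => by
        rw [uIoc_of_le ht.1] at hr
        have hr' : r ∈ Icc θ (θ + ω) := ⟨hr.1.le, hr.2.trans ht.2⟩
        refine ((S (t - r)).le_of_opNorm_le (hM _ ?_) _).trans ?_
        · rw [abs_of_nonneg (by linarith [hr.2])]; linarith [hr.1, ht.2]
        · gcongr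
          exact (hN.norm_sub_le (hUb r hr') (hVb r hr')).trans (by gcongr; exact hmax' r hr')
    refine h.trans ?_
    rw [abs_of_nonneg (by linarith [ht.1])]
    calc M * (ℓ ϱ * m) * (t - θ) ≤ M * (ℓ ϱ * m) * ω := by
          gcongr; linarith [ht.2]
      _ = M * ℓ ϱ * ω * m := by ring
  have hm0 : 0 ≤ m := norm_nonneg _
  have hm2 : m ≤ 2 * M * ‖U θ - V θ‖ := by
    have h1 := hduh τ hτ
    have h2 : ‖S (τ - θ) (U θ - V θ)‖ ≤ M * ‖U θ - V θ‖ :=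
      (S (τ - θ)).le_of_opNorm_le
        (hM _ (by rw [abs_of_nonneg (by linarith [hτ.1])]; linarith [hτ.2])) _
    have h3 := norm_le_norm_sub_add (U τ - V τ) (S (τ - θ) (U θ - V θ))
    rw [← hm] at h3
    have h4 : M * ℓ ϱ * ω * m ≤ 1 / 2 * m := by gcongr
    linarith
  have hend := hduh (θ + ω) hθω
  rw [hUr, hVr, add_sub_cancel_left] at hend
  have hD : ‖U θ - V θ‖ ≤ k * (M * ℓ ϱ * ω) * (2 * M) * ‖U θ - V θ‖ := by
    calc ‖U θ - V θ‖ = ‖R ((1 - S ω) (U θ - V θ))‖ := by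
          rw [← mul_apply_eq_comp, hR, one_apply_eq_self]
      _ ≤ k * ‖(1 - S ω) (U θ - V θ)‖ := R.le_of_opNorm_le hk _
      _ ≤ k * (M * ℓ ϱ * ω * (2 * M * ‖U θ - V θ‖)) := by
          gcongr
          rw [sub_apply, one_apply_eq_self]
          exact hend.trans (by gcongr)
      _ = _ := by ring
  have : ‖U θ - V θ‖ = 0 := by
    by_contra hne
    have hpos := lt_of_le_of_ne (norm_nonneg (U θ - V θ)) (Ne.symm hne)
    nlinarith
  exact sub_eq_zero.1 (norm_eq_zero.1 this)

/-- Under non-resonance, a nonlinearity that is flat at the origin and a forcing of size `ε`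
produce near the periodic response of the linear problem exactly one periodic solution. -/
theorem exists_periodic_near_response [CompleteSpace X] (hS : IsC0Group S) {R : X →L[ℝ] X} {ω : ℝ}
    (hω : 0 < ω) (hR₁ : R * (1 - S ω) = 1) (hR₂ : (1 - S ω) * R = 1) {N : X → X} {ℓ : ℝ≥0 → ℝ≥0}
    (hN : IsLipschitzOnBalls N ℓ) (hℓ : Filter.Tendsto ℓ (𝓝 0) (𝓝 0)) {g : ℝ → X}
    (hg : Continuous g) (hper : Function.Periodic g ω) :
    ∃ ρ ε₀ : ℝ, 0 < ε₀ ∧ ε₀ ≤ ρ ∧ ∀ ε : ℝ, 0 < ε → ε < ε₀ → ∃ U : ℝ → X,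
      IsMild S (fun r x => N x + ε • g r) univ U ∧ Function.Periodic U ω ∧
      (∀ t, dist (U t) (periodicResponse S R ω (fun r => ε • g r) t) ≤ ε) ∧
      ∀ θ, ∀ x ∈ closedBall (periodicResponse S R ω (fun r => ε • g r) θ) ρ, ∃ V,
        IsMild S (fun r x => N x + ε • g r) (Icc θ (θ + ω)) V ∧ V θ = x ∧
          (V (θ + ω) = x → x = U θ) := by
  obtain ⟨M, hM1, hM⟩ : ∃ M : ℝ≥0, 1 ≤ M ∧ ∀ t, |t| ≤ ω → ‖S t‖ ≤ M := by
    obtain ⟨M, hM⟩ := hS.exists_bound ω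
    exact ⟨M + 1, by simp, fun t ht => (hM t ht).trans (by simp)⟩
  obtain ⟨c, hc⟩ : ∃ c : ℝ≥0, ∀ t, ‖g t‖ ≤ c := by
    obtain ⟨c, hc⟩ := (hper.isBounded_of_continuous hω.ne' hg).exists_norm_le
    exact ⟨c.toNNReal, fun t => (hc _ (mem_range_self t)).trans (le_coe_toNNReal c)⟩
  set k : ℝ := ‖R‖
  have hk0 : 0 ≤ k := norm_nonneg R
  -- the linear response to a forcing of size `ε` has size at most `ε * b`
  obtain ⟨b, hb⟩ : ∃ b : ℝ, b = k * (M * c * ω) := ⟨_, rfl⟩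
  have hb0 : 0 ≤ b := by rw [hb]; positivity
  -- All smallness conditions ask that `M ℓ(ϱ) ω` be small against one of `1`, `M`, `k`, `k M`,
  -- `k (b + 1)`, and `M (k + 1) (b + 1)` dominates these since `M ≥ 1`.
  obtain ⟨ϱ, hϱ, hϱ0⟩ : ∃ ϱ : ℝ≥0, (M * ℓ ϱ * ω * (M * (k + 1) * (b + 1)) : ℝ) < 1 / 4 ∧ 0 < ϱ := by
    have h : Filter.Tendsto (fun ϱ => (M * ℓ ϱ * ω * (M * (k + 1) * (b + 1)) : ℝ)) (𝓝[>] 0)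
        (𝓝 (M * (0 : ℝ≥0) * ω * (M * (k + 1) * (b + 1)))) :=
      ((((NNReal.tendsto_coe.2 (hℓ.mono_left nhdsWithin_le_nhds)).const_mul _).mul_const
        _).mul_const _)
    simp only [NNReal.coe_zero, mul_zero, zero_mul] at h
    exact ((h.eventually_lt_const (by norm_num)).and self_mem_nhdsWithin).exists
  have hM1' : (1 : ℝ) ≤ M := by exact_mod_cast hM1
  have hM0 : (0 : ℝ) < M := by linarith
  have hϱ0' : (0 : ℝ) < ϱ := by exact_mod_cast hϱ0
  obtain ⟨q, hq⟩ : ∃ q : ℝ, q = M * ℓ ϱ * ω := ⟨_, rfl⟩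
  rw [← hq] at hϱ
  have hq0 : 0 ≤ q := by rw [hq]; positivity
  have hqle : ∀ z, z ≤ M * (k + 1) * (b + 1) → q * z ≤ 1 / 4 := fun z hz =>
    (mul_le_mul_of_nonneg_left hz hq0).trans hϱ.le
  have hMk : 1 * (k + 1) ≤ M * (k + 1) := by gcongr
  have hMkb : M * (k + 1) * 1 ≤ M * (k + 1) * (b + 1) := by gcongr; linarith
  have hkb : 1 * (k + 1) * (b + 1) ≤ M * (k + 1) * (b + 1) := by gcongr
  have hq1 : q ≤ 1 / 4 := by simpa using hqle 1 (by linarith)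
  have hqM : q * M ≤ 1 / 4 := hqle M (by nlinarith)
  have hqkM : q * (k * M) ≤ 1 / 4 := hqle (k * M) (by nlinarith)
  have hqk : q * k ≤ 1 / 4 := hqle k (by linarith)
  have hqkb : q * (k * (b + 1)) ≤ 1 / 4 := hqle _ (by nlinarith)
  -- `ε σ ≤ ϱ / (2 M)` leaves half of the radius `ϱ / M` of the Picard-Lindelöf ball for the radius
  -- `ρ` and the nonlinearity, which take `ϱ / (4 M)` each.
  obtain ⟨σ, hσ⟩ : ∃ σ : ℝ, σ = M * c * ω + b + 1 := ⟨_, rfl⟩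
  have hσ0 : 0 < σ := by rw [hσ]; positivity
  refine ⟨ϱ / (4 * M), min (ϱ / (4 * M)) (ϱ / (2 * M) / σ), by positivity, min_le_left _ _,
    fun ε hε hεlt => ?_⟩
  have hεσ : ε * σ ≤ ϱ / (2 * M) := by
    rw [← le_div_iff₀ hσ0]; exact hεlt.le.trans (min_le_right _ _)
  have hϱM : (ϱ / (2 * M) : ℝ) ≤ ϱ := by
    rw [div_le_iff₀ (by positivity)]; nlinarith
  have hεg : Continuous fun r => ε • g r := hg.const_smul ε
  have hεper : Function.Periodic (fun r => ε • g r) ω := fun t => by simp only [hper t]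
  have hεc : ∀ t, ‖ε • g t‖ ≤ ε * c := fun t => by
    rw [norm_smul, norm_of_nonneg hε.le]; gcongr; exact hc t
  have hw : ∀ t, ‖periodicResponse S R ω (fun r => ε • g r) t‖ ≤ ε * b := fun t =>
    (norm_periodicResponse_le hω.le le_rfl hM hεc t).trans_eq (by rw [hb]; ring)
  have hεb : ε * b + ε ≤ ϱ := by
    have h1 : 0 ≤ ε * (M * c * ω) := by positivity
    have h2 : ε * σ = ε * (M * c * ω) + ε * b + ε := by rw [hσ]; ring
    linarith
  obtain ⟨U, hU, hUper, hUW⟩ := exists_periodic_isMild hS hω.le hR₁ hR₂ hN hεg hεper hεc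
    (k := k) (e := ε) le_rfl hM hε.le hw hεb
    (by rw [← hq]; linarith)
    (by
      rw [← hq]
      have h : q * (k * (b + 1)) * ε ≤ 1 / 4 * ε := by gcongr
      linarith)
  refine ⟨U, hU, hUper, hUW, fun θ x hx => ?_⟩
  have hF : Continuous fun z : ℝ × X => N z.2 + ε • g z.1 :=
    (hN.continuous.comp continuous_snd).add (hεg.comp continuous_fst)
  have hxr : ‖x‖ ≤ ϱ / (4 * M) + ε * b := by
    rw [mem_closedBall, dist_eq_norm] at hx
    have := norm_le_norm_add_norm_sub' x (periodicResponse S R ω (fun r => ε • g r) θ)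
    linarith [hw θ]
  obtain ⟨V, hV, hVθ, hVb⟩ := exists_isMild_of_small hS (F := fun r x => N x + ε • g r) hF
    (θ := θ) hω.le (M := M) (K := ℓ ϱ)
    (R := ϱ) (r := ⟨ϱ / (4 * M) + ε * b, by positivity⟩) (B := ⟨ℓ ϱ * ϱ + ε * c, by positivity⟩)
    hM0 hM (fun t => by
      refine LipschitzOnWith.of_dist_le_mul fun y hy z hz => ?_
      rw [dist_add_right]
      exact (hN.lipschitzOnWith ϱ).dist_le_mul y hy z hz)
    (fun t y hy => by
      rw [mem_closedBall_zero_iff] at hy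
      exact (norm_add_le (N y) (ε • g t)).trans
        (add_le_add ((hN.norm_le hy).trans (by gcongr)) (hεc t)))
    (by
      change (M * (ℓ ϱ * ϱ + ε * c) * ω : ℝ) ≤ ϱ / M - (ϱ / (4 * M) + ε * b)
      have e1 : (M * (ℓ ϱ * ϱ + ε * c) * ω : ℝ) = q * ϱ + ε * (M * c * ω) := by rw [hq]; ring
      have e2 : q * ϱ ≤ ϱ / (4 * M) := by
        rw [le_div_iff₀ (by positivity)]
        linarith [mul_le_mul_of_nonneg_right hqM hϱ0'.le]
      have e3 : (ϱ / M : ℝ) = ϱ / (4 * M) + ϱ / (4 * M) + ϱ / (2 * M) := by field_simp; norm_num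
      have e4 : ε * (M * c * ω) + ε * b ≤ ε * σ := by rw [hσ]; linarith
      linarith)
    hxr
  refine ⟨V, hV, hVθ, fun hVr => ?_⟩
  have hUI : IsMild S (fun r x => N x + ε • g r) (Icc θ (θ + ω)) U :=
    ⟨hU.continuousOn.mono (subset_univ _), fun s _ t _ => hU.duhamel s trivial t trivial⟩
  rw [← hVθ]
  refine IsMild.eq_of_return hS hω.le hR₁ hN hεg le_rfl hM (ϱ := ϱ) ?_ ?_ hV hUI hVb
    (fun t _ => ?_) (hVr.trans hVθ.symm) (hUper θ)
  · rw [← hq]; linarith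
  · rw [← hq]; linarith
  · have h1 := hUW t
    rw [dist_eq_norm] at h1
    have := norm_le_norm_add_norm_sub' (U t) (periodicResponse S R ω (fun r => ε • g r) t)
    linarith [hw t]

end FixedPoints

/-! ### The group generated by the linear beam -/

section Diagonal

theorem diag_apply (b : ℕ → ℝ) (hb : ∃ C, ∀ n, |b n| ≤ C) (x : Seq2) (n : ℕ) :
    diag b hb x n = b n * x n := rfl

theorem norm_diag_apply_le (b : ℕ → ℝ) (hb : ∃ C, ∀ n, |b n| ≤ C) {C : ℝ} (hC : ∀ n, |b n| ≤ C)
    (x : Seq2) : ‖diag b hb x‖ ≤ C * ‖x‖ := by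
  have hC0 : 0 ≤ C := (abs_nonneg _).trans (hC 0)
  refine (lp.norm_mono (y := C • x) two_ne_zero fun n => ?_).trans_eq ?_
  · rw [diag_apply, lp.coeFn_smul, Pi.smul_apply, smul_eq_mul, norm_mul, norm_mul,
      Real.norm_eq_abs, Real.norm_of_nonneg hC0]
    gcongr
    exact hC n
  · rw [norm_smul, Real.norm_of_nonneg hC0]

theorem norm_sq_eq_tsum (x : Seq2) : ‖x‖ ^ 2 = ∑' n, x n ^ 2 := by
  have h := lp.norm_rpow_eq_tsum (p := 2) (by norm_num) x
  simpa using h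

theorem summable_sq (x : Seq2) : Summable fun n => x n ^ 2 := by
  have h := (lp.memℓp x).summable (by norm_num)
  simpa using h

/-- Diagonal operators depend continuously, in the strong topology, on entries that are
continuous and locally uniformly bounded. -/
theorem continuous_diag {b : ℝ → ℕ → ℝ} (hb : ∀ t, ∃ C, ∀ n, |b t n| ≤ C)
    (hcont : ∀ n, Continuous fun t => b t n)
    (hloc : ∀ T, ∃ C, ∀ t, |t| ≤ T → ∀ n, |b t n| ≤ C) :
    Continuous fun q : ℝ × Seq2 => diag (b q.1) (hb q.1) q.2 := by
  rw [continuous_iff_continuousAt]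
  rintro ⟨t₀, x₀⟩
  obtain ⟨C, hC⟩ := hloc (|t₀| + 1)
  have hev : ∀ᶠ t in 𝓝 t₀, |t| ≤ |t₀| + 1 :=
    (continuous_abs.tendsto t₀).eventually_le_const (by linarith)
  have ht₀ : ∀ n, |b t₀ n| ≤ C := hC t₀ (by linarith)
  have h1 : Filter.Tendsto (fun t => ‖diag (b t) (hb t) x₀ - diag (b t₀) (hb t₀) x₀‖) (𝓝 t₀)
      (𝓝 0) := by
    have hsq : Filter.Tendsto (fun t => ∑' n, ((b t n - b t₀ n) * x₀ n) ^ 2) (𝓝 t₀)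
        (𝓝 (∑' _ : ℕ, (0 : ℝ))) := by
      refine tendsto_tsum_of_dominated_convergence (bound := fun n => (2 * C) ^ 2 * x₀ n ^ 2)
        ((summable_sq x₀).mul_left _) (fun n => ?_) ?_
      · have : Continuous fun t => ((b t n - b t₀ n) * x₀ n) ^ 2 := by
          have := hcont n
          fun_prop
        simpa using this.tendsto t₀
      · filter_upwards [hev] with t ht n
        rw [Real.norm_of_nonneg (sq_nonneg _), mul_pow]
        refine mul_le_mul_of_nonneg_right (sq_le_sq' ?_ ?_) (sq_nonneg _) <;>
          linarith [abs_le.1 (hC t ht n), abs_le.1 (ht₀ n)]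
    have hs := hsq.sqrt
    simp only [tsum_zero, sqrt_zero] at hs
    refine hs.congr fun t => ?_
    rw [← sqrt_sq (norm_nonneg (diag (b t) (hb t) x₀ - _)), norm_sq_eq_tsum]
    congr 2
    funext n
    rw [lp.coeFn_sub, Pi.sub_apply, diag_apply, diag_apply, sub_mul]
  rw [ContinuousAt, tendsto_iff_norm_sub_tendsto_zero]
  refine squeeze_zero' (g := fun q : ℝ × Seq2 => C * ‖q.2 - x₀‖ +
    ‖diag (b q.1) (hb q.1) x₀ - diag (b t₀) (hb t₀) x₀‖) (.of_forall fun _ => norm_nonneg _) ?_ ?_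
  · filter_upwards [(continuous_fst.tendsto (t₀, x₀)).eventually hev] with q hq
    refine (norm_sub_le_norm_sub_add_norm_sub _ (diag (b q.1) (hb q.1) x₀) _).trans ?_
    gcongr
    rw [← map_sub]
    exact norm_diag_apply_le _ _ (hC _ hq) _
  · have h2 : Filter.Tendsto (fun q : ℝ × Seq2 => C * ‖q.2 - x₀‖) (𝓝 (t₀, x₀)) (𝓝 0) := by
      have : Continuous fun q : ℝ × Seq2 => C * ‖q.2 - x₀‖ := by fun_prop
      simpa using this.tendsto (t₀, x₀)
    simpa using h2.add (h1.comp (continuous_fst.tendsto (t₀, x₀)))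

end Diagonal

namespace Beam

variable (p : Beam)

theorem modeExp_add (s t : ℝ) (n : ℕ) : p.modeExp (s + t) n = p.modeExp s n * p.modeExp t n := by
  rw [modeExp, add_smul, Matrix.exp_add_of_commute _ _
    (((Commute.refl (p.mode n)).smul_left s).smul_right t)]
  rfl

theorem continuous_modeExp (n : ℕ) (i j : Fin 2) : Continuous fun t => p.modeExp t n i j :=
  continuous_iff_continuousAt.2 fun t => (p.hasDerivAt_modeExp n t i j).continuousAt

/-- The energy estimate bounds the entries of `e ^ (t A)`, in the coordinates of the phase space,
uniformly in the mode and locally uniformly in time. -/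
theorem modeExp_bounds (T : ℝ) : ∃ C, ∀ t, |t| ≤ T → ∀ n : ℕ,
    |p.modeExp t n 0 0| ≤ C ∧ |((n : ℝ) + 1) * p.modeExp t n 0 1| ≤ C ∧
    |((n : ℝ) + 1)⁻¹ * p.modeExp t n 1 0| ≤ C ∧ |p.modeExp t n 1 1| ≤ C := by
  have ha := p.α_pos
  have hg := p.γ_pos
  have hm := p.μ_pos
  have hD : 0 ≤ p.β / p.μ + p.δ := (p.damp_nonneg 0).trans (p.damp_le 0)
  set E := exp (2 * (p.β / p.μ + p.δ) * T) with hE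
  have hE0 : 0 < E := exp_pos _
  set c₁ := (1 + p.μ) / p.α with hc₁
  set c₂ := (p.α + p.γ) / p.μ with hc₂
  have hc₁0 : 0 < c₁ := by positivity
  have hc₂0 : 0 < c₂ := by positivity
  have hEc₁ : 0 < E * c₁ := by positivity
  have hEc₂ : 0 < E * c₂ := by positivity
  refine ⟨√(E * (1 + c₁ + c₂)), fun t ht n => ?_⟩
  have hexp : exp (2 * (p.β / p.μ + p.δ) * |t|) ≤ E := exp_le_exp.2 (by gcongr)
  have hk := p.stiff_pos n
  have hN : (0 : ℝ) < ((n : ℝ) + 1) ^ 2 := by positivity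
  have e0 := p.energy_le n t 0
  have e1 := p.energy_le n t 1
  simp only [modeExp_zero, Matrix.one_apply_eq, Matrix.one_apply_ne (one_ne_zero (α := Fin 2)),
    Matrix.one_apply_ne (zero_ne_one (α := Fin 2))] at e0 e1
  have f0 : p.stiff n * p.modeExp t n 0 0 ^ 2 + p.modeExp t n 1 0 ^ 2 ≤ E * p.stiff n := by
    refine e0.trans ?_
    norm_num
    gcongr
  have f1 : p.stiff n * p.modeExp t n 0 1 ^ 2 + p.modeExp t n 1 1 ^ 2 ≤ E := by
    refine e1.trans ?_
    norm_num
    exact hexp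
  have g00 := mul_nonneg hk.le (sq_nonneg (p.modeExp t n 0 0))
  have g01 := mul_nonneg hk.le (sq_nonneg (p.modeExp t n 0 1))
  refine ⟨abs_le_sqrt ?_, abs_le_sqrt ?_, abs_le_sqrt ?_, abs_le_sqrt ?_⟩
  · have h : p.stiff n * p.modeExp t n 0 0 ^ 2 ≤ p.stiff n * E := by
      linarith [sq_nonneg (p.modeExp t n 1 0)]
    linarith [le_of_mul_le_mul_left h hk]
  · have h : ((n : ℝ) + 1) ^ 2 * p.modeExp t n 0 1 ^ 2 ≤ E * c₁ := by
      have hl : ((n : ℝ) + 1) ^ 2 ≤ c₁ * p.stiff n := by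
        have h' := mul_le_mul_of_nonneg_left (p.le_stiff n) hc₁0.le
        have e : c₁ * (p.α / (1 + p.μ) * ((n : ℝ) + 1) ^ 2) = ((n : ℝ) + 1) ^ 2 := by
          rw [hc₁]; field_simp
        rwa [e] at h'
      calc ((n : ℝ) + 1) ^ 2 * p.modeExp t n 0 1 ^ 2
          ≤ c₁ * p.stiff n * p.modeExp t n 0 1 ^ 2 := by gcongr
        _ = c₁ * (p.stiff n * p.modeExp t n 0 1 ^ 2) := by ring
        _ ≤ c₁ * E := by gcongr; linarith [sq_nonneg (p.modeExp t n 1 1)]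
        _ = E * c₁ := mul_comm _ _
    rw [mul_pow]
    linarith
  · have h : p.modeExp t n 1 0 ^ 2 / ((n : ℝ) + 1) ^ 2 ≤ E * c₂ := by
      rw [div_le_iff₀ hN]
      have h' := mul_le_mul_of_nonneg_left (p.stiff_le n) hE0.le
      rw [← hc₂] at h'
      linarith
    rw [mul_pow, inv_pow, ← div_eq_inv_mul]
    linarith
  · linarith

theorem repr_semigroup_fst (t : ℝ) (U : Phase) (n : ℕ) :
    cosBasis.repr (p.semigroup t U).1 n = p.modeExp t n 0 0 * cosBasis.repr U.1 n +
      (n + 1) * p.modeExp t n 0 1 * sineBasis.repr U.2 n := by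
  simp only [semigroup, ContinuousLinearMap.prod_apply]
  change cosBasis.repr (cosBasis.repr.symm _) n = _
  rw [LinearIsometryEquiv.apply_symm_apply]
  rfl

theorem repr_semigroup_snd (t : ℝ) (U : Phase) (n : ℕ) :
    sineBasis.repr (p.semigroup t U).2 n = ((n : ℝ) + 1)⁻¹ * p.modeExp t n 1 0 * cosBasis.repr U.1 n
      + p.modeExp t n 1 1 * sineBasis.repr U.2 n := by
  simp only [semigroup, ContinuousLinearMap.prod_apply]
  change sineBasis.repr (sineBasis.repr.symm _) n = _
  rw [LinearIsometryEquiv.apply_symm_apply]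
  rfl

theorem continuous_semigroup : Continuous fun q : ℝ × Phase => p.semigroup q.1 q.2 := by
  have hU : Continuous fun q : ℝ × Phase => (q.1, cosBasis.repr q.2.1) :=
    continuous_fst.prodMk (cosBasis.repr.continuous.comp (continuous_fst.comp continuous_snd))
  have hV : Continuous fun q : ℝ × Phase => (q.1, sineBasis.repr q.2.2) :=
    continuous_fst.prodMk (sineBasis.repr.continuous.comp (continuous_snd.comp continuous_snd))
  have hb := p.modeExp_bounds
  have h00 := continuous_diag p.bound00 (fun n => p.continuous_modeExp n 0 0)
    (fun T => (hb T).imp fun C hC t ht n => (hC t ht n).1)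
  have h01 := continuous_diag p.bound01 (fun n => (p.continuous_modeExp n 0 1).const_mul _)
    (fun T => (hb T).imp fun C hC t ht n => (hC t ht n).2.1)
  have h10 := continuous_diag p.bound10 (fun n => (p.continuous_modeExp n 1 0).const_mul _)
    (fun T => (hb T).imp fun C hC t ht n => (hC t ht n).2.2.1)
  have h11 := continuous_diag p.bound11 (fun n => p.continuous_modeExp n 1 1)
    (fun T => (hb T).imp fun C hC t ht n => (hC t ht n).2.2.2)
  exact (cosBasis.repr.symm.continuous.comp ((h00.comp hU).add (h01.comp hV))).prodMk
    (sineBasis.repr.symm.continuous.comp ((h10.comp hU).add (h11.comp hV)))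

end Beam

theorem Phase.ext_repr {U V : Phase} (h₁ : ∀ n, cosBasis.repr U.1 n = cosBasis.repr V.1 n)
    (h₂ : ∀ n, sineBasis.repr U.2 n = sineBasis.repr V.2 n) : U = V :=
  Prod.ext (cosBasis.repr.injective (lp.ext (funext h₁)))
    (sineBasis.repr.injective (lp.ext (funext h₂)))

theorem Beam.isC0Group_semigroup (p : Beam) : IsC0Group p.semigroup where
  zero := by
    refine ContinuousLinearMap.ext fun U => ?_
    refine Phase.ext_repr (fun n => ?_) fun n => ?_
    · rw [p.repr_semigroup_fst, p.modeExp_zero]; simp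
    · rw [p.repr_semigroup_snd, p.modeExp_zero]; simp
  add s t := by
    refine ContinuousLinearMap.ext fun U => ?_
    refine Phase.ext_repr (fun n => ?_) fun n => ?_
    · rw [mul_apply_eq_comp]
      simp only [p.repr_semigroup_fst, p.repr_semigroup_snd, p.modeExp_add, Matrix.mul_apply,
        Fin.sum_univ_two]
      field_simp
      ring
    · rw [mul_apply_eq_comp]
      simp only [p.repr_semigroup_fst, p.repr_semigroup_snd, p.modeExp_add, Matrix.mul_apply,
        Fin.sum_univ_two]
      field_simp
      ring
  continuous := p.continuous_semigroup

/-! ### The nonlinearity -/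

section Nemytskii

/-- The constant `√π`, written as a power of the total mass: the norm of the embedding of bounded
functions into `L²(0, π)`, and also a bound for the embedding of `H¹₀(0, π)` into bounded
functions. -/
noncomputable def boundedEmbedding : ℝ≥0 := measureUnivNNReal vol ^ (2 : ℝ≥0∞).toReal⁻¹

theorem norm_le_of_ae_bound {w : L2} {C : ℝ} (hC : 0 ≤ C) (h : ∀ᵐ x ∂vol, ‖w x‖ ≤ C) :
    ‖w‖ ≤ boundedEmbedding * C :=
  (Lp.norm_le_of_ae_bound hC h).trans_eq (by rw [boundedEmbedding, NNReal.coe_rpow])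

/-- The displacement at `x ∈ (0, π)` is the inner product of `u_x` with the indicator function
of `(0, x]`. -/
theorem disp_eq_inner {x : ℝ} (hx : x ∈ Ioo 0 π) (U : Phase) :
    disp U x = inner ℝ (indicatorConstLp 2 measurableSet_Ioc (measure_ne_top vol (Ioc 0 x)) (1 : ℝ))
      U.1.1 := by
  rw [L2.inner_indicatorConstLp_one, disp, intervalIntegral.integral_of_le hx.1.le,
    Measure.restrict_restrict measurableSet_Ioc, inter_eq_left.2]
  exact fun y hy => ⟨hy.1, hy.2.trans_lt hx.2⟩

theorem disp_sub {x : ℝ} (hx : x ∈ Ioo 0 π) (U V : Phase) :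
    disp U x - disp V x = disp (U - V) x := by
  simp only [disp_eq_inner hx, ← inner_sub_right]
  rfl

/-- The embedding of `H¹₀(0, π)` into the bounded functions, by the Cauchy-Schwarz inequality. -/
theorem abs_disp_le {x : ℝ} (hx : x ∈ Ioo 0 π) (U : Phase) :
    |disp U x| ≤ boundedEmbedding * ‖U‖ := by
  rw [disp_eq_inner hx]
  refine (abs_real_inner_le_norm _ _).trans ?_
  have h1 : ‖(indicatorConstLp 2 measurableSet_Ioc (measure_ne_top vol (Ioc 0 x)) (1 : ℝ) : L2)‖ ≤
      boundedEmbedding * 1 := by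
    refine norm_le_of_ae_bound zero_le_one ?_
    filter_upwards [indicatorConstLp_coeFn (p := 2) (hs := measurableSet_Ioc)
      (hμs := measure_ne_top vol (Ioc 0 x)) (c := (1 : ℝ))] with y hy
    rw [hy]
    exact (norm_indicator_le_norm_self _ _).trans (by simp)
  rw [mul_one] at h1
  gcongr
  exact norm_fst_le U

/-- By the mean value theorem `f` is Lipschitz on `[-r, r]` with constant `C r ^ (m - 1)`. -/
theorem IsAdmissible.exists_lipschitz {f : C(ℝ, ℝ)} {m : ℝ} (hm : 1 < m) (hf : IsAdmissible f m) :
    ∃ C : ℝ≥0, ∀ r : ℝ≥0, ∀ a b : ℝ, |a| ≤ r → |b| ≤ r →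
      |f a - f b| ≤ C * r ^ (m - 1) * |a - b| := by
  obtain ⟨C, hC⟩ := hf.growth_deriv
  refine ⟨C.toNNReal, fun r a b ha hb => ?_⟩
  have hball : ∀ {z : ℝ}, |z| ≤ r → z ∈ closedBall (0 : ℝ) r := fun h => by
    rwa [mem_closedBall_zero_iff]
  refine (convex_closedBall (0 : ℝ) r).norm_image_sub_le_of_norm_deriv_le (𝕜 := ℝ)
    (fun x _ => (hf.contDiff.differentiable one_ne_zero).differentiableAt) (fun x hx => ?_)
    (hball hb) (hball ha)
  rw [mem_closedBall_zero_iff] at hx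
  refine (hC x).trans ?_
  have h1 : |x| ^ (m - 1) ≤ (r : ℝ) ^ (m - 1) := rpow_le_rpow (abs_nonneg x) hx (by linarith)
  exact mul_le_mul (le_coe_toNNReal C) h1 (by positivity) (NNReal.coe_nonneg _)

/-- The superposition operator inherits the local Lipschitz constant of `f`, as the norm of the
phase space controls the maximum of the displacement. -/
theorem norm_nonlin_sub_le {f : C(ℝ, ℝ)} {R L : ℝ≥0}
    (hf : ∀ a b : ℝ, |a| ≤ boundedEmbedding * R → |b| ≤ boundedEmbedding * R →
      |f a - f b| ≤ L * |a - b|) {U V : Phase} (hU : ‖U‖ ≤ R) (hV : ‖V‖ ≤ R) :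
    ‖nonlin f U - nonlin f V‖ ≤ boundedEmbedding * (L * (boundedEmbedding * ‖U - V‖)) := by
  refine norm_le_of_ae_bound (by positivity) ?_
  filter_upwards [Lp.coeFn_sub (nonlin f U) (nonlin f V), (memLp_comp_disp f U).coeFn_toLp,
    (memLp_comp_disp f V).coeFn_toLp, ae_restrict_mem measurableSet_Ioo] with x h h₁ h₂ hx
  rw [h, Pi.sub_apply, nonlin, nonlin, h₁, h₂]
  refine (hf _ _ ((abs_disp_le hx U).trans (by gcongr)) ((abs_disp_le hx V).trans
    (by gcongr))).trans ?_
  rw [disp_sub hx]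
  gcongr
  exact abs_disp_le hx _

theorem nonlin_eq_zero {f : C(ℝ, ℝ)} {U : Phase} (h : ∀ x ∈ Ioo 0 π, f (disp U x) = 0) :
    nonlin f U = 0 := by
  refine (Lp.eq_zero_iff_ae_eq_zero).2 ?_
  filter_upwards [(memLp_comp_disp f U).coeFn_toLp, ae_restrict_mem measurableSet_Ioo] with x hx hx'
  rw [nonlin, hx, h x hx', Pi.zero_apply]

/-- A force density `w` as an inhomogeneity `(0, M⁻¹ w)` of the first order system. -/
noncomputable def Beam.force (p : Beam) : L2 →L[ℝ] Phase :=
  ContinuousLinearMap.inr ℝ H10 L2 ∘L p.massInv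

theorem IsAdmissible.isLipschitzOnBalls {f : C(ℝ, ℝ)} {m : ℝ} (hm : 1 < m) (hf : IsAdmissible f m)
    (p : Beam) : ∃ ℓ : ℝ≥0 → ℝ≥0, IsLipschitzOnBalls (fun U => p.force (nonlin f U)) ℓ ∧
      Filter.Tendsto ℓ (𝓝 0) (𝓝 0) := by
  obtain ⟨C, hC⟩ := hf.exists_lipschitz hm
  refine ⟨fun R => ‖p.force‖₊ * (boundedEmbedding * (C * (boundedEmbedding * R) ^ (m - 1) *
    boundedEmbedding)), ⟨?_, fun R => ?_⟩, ?_⟩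
  · have h : nonlin f (0 : Phase) = 0 := nonlin_eq_zero fun x hx => by
      rw [disp_eq_inner hx]
      exact (congrArg f (inner_zero_right _)).trans hf.zero
    simp only [h, map_zero]
  · refine LipschitzOnWith.of_dist_le_mul fun U hU V hV => ?_
    rw [mem_closedBall_zero_iff] at hU hV
    rw [dist_eq_norm, dist_eq_norm, ← map_sub]
    refine (p.force.le_opNorm _).trans ?_
    have h := norm_nonlin_sub_le (L := C * (boundedEmbedding * R) ^ (m - 1))
      (fun a b ha hb => by
        have := hC (boundedEmbedding * R) a b (by simpa using ha) (by simpa using hb)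
        simpa using this) hU hV
    refine (mul_le_mul_of_nonneg_left h (norm_nonneg _)).trans_eq ?_
    push_cast
    ring
  · have h : Continuous fun R : ℝ≥0 => ‖p.force‖₊ * (boundedEmbedding *
        (C * (boundedEmbedding * R) ^ (m - 1) * boundedEmbedding)) := by
      have := NNReal.continuous_rpow_const (y := m - 1) (by linarith)
      fun_prop
    have h0 := h.tendsto 0
    rwa [mul_zero, NNReal.zero_rpow (by linarith), mul_zero, zero_mul, mul_zero, mul_zero] at h0

end Nemytskii

/-! ### Solutions of the beam equation as mild solutions of the abstract equation -/

theorem isMildSolution_iff (p : Beam) (f : C(ℝ, ℝ)) (ε : ℝ) (h : ℝ → L2) (I : Set ℝ)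
    (U : ℝ → Phase) : IsMildSolution p f (fun t => ε • h t) I U ↔
      IsMild p.semigroup (fun r x => p.force (nonlin f x) + ε • p.force (h r)) I U := by
  have e : ∀ r, ((0, p.massInv (nonlin f (U r) + ε • h r)) : Phase) =
      p.force (nonlin f (U r)) + ε • p.force (h r) := fun r => by
    rw [← map_smul, ← map_add]; rfl
  constructor
  · rintro ⟨h1, h2⟩
    exact ⟨h1, by simpa only [e] using h2⟩
  · rintro ⟨h1, h2⟩
    exact ⟨h1, by simpa only [e] using h2⟩

theorem isMildSolution_zero_iff (p : Beam) (ε : ℝ) (h : ℝ → L2) (I : Set ℝ)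
    (U : ℝ → Phase) : IsMildSolution p 0 (fun t => ε • h t) I U ↔
      IsMild p.semigroup (fun r _ => ε • p.force (h r)) I U := by
  rw [isMildSolution_iff]
  simp only [nonlin_eq_zero (f := 0) fun _ _ => rfl, map_zero, zero_add]

theorem IsMildSolution.mono {p : Beam} {f : C(ℝ, ℝ)} {g : ℝ → L2} {I J : Set ℝ} {U : ℝ → Phase}
    (hU : IsMildSolution p f g I U) (hJ : J ⊆ I) : IsMildSolution p f g J U :=
  ⟨hU.continuousOn.mono hJ, fun s hs t ht => hU.duhamel s (hJ hs) t (hJ ht)⟩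

/-- Periodic solutions that agree on one period agree everywhere. -/
theorem IsPeriodicSolution.eq_of_eqOn {p : Beam} {f : C(ℝ, ℝ)} {g : ℝ → L2} {ω θ : ℝ} (hω : 0 < ω)
    {U V : ℝ → Phase} (hU : IsPeriodicSolution p f g ω U) (hV : IsPeriodicSolution p f g ω V)
    (h : EqOn U V (Icc θ (θ + ω))) : U = V := by
  funext t
  obtain ⟨n, hn, -⟩ := existsUnique_sub_zsmul_mem_Ico hω t θ
  rw [← hU.periodic.sub_zsmul_eq n, ← hV.periodic.sub_zsmul_eq n]
  exact h ⟨hn.1, hn.2.le⟩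

end RayleighBeam

open RayleighBeam Metric in
theorem lemma7p3 (p : RayleighBeam.Beam) (f : C(ℝ, ℝ)) (m : ℝ) (hm : 1 < m)
    (hf : RayleighBeam.IsAdmissible f m) (ω : ℝ) (hω : 0 < ω)
    (h : ℝ → RayleighBeam.L2) (hh : ContDiff ℝ 1 h) (hper : Function.Periodic h ω)
    (hres : (1 : ℝ) ∉ spectrum ℝ (p.semigroup ω)) :
    ∃ ρ : ℝ, ∃ ε₀ : ℝ, 0 < ε₀ ∧ ε₀ ≤ ρ ∧ ∀ ε : ℝ, 0 < ε → ε < ε₀ →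
      ∃ W : ℝ → RayleighBeam.Phase,
        -- the unique periodic solution of the linear forced problem
        (RayleighBeam.IsPeriodicSolution p 0 (fun t => ε • h t) ω W ∧
          ∀ V, RayleighBeam.IsPeriodicSolution p 0 (fun t => ε • h t) ω V → V = W) ∧
        -- the period maps are well defined near it and have a unique fixed point there
        (∀ θ : ℝ,
          (∀ U V : ℝ → RayleighBeam.Phase,
            RayleighBeam.IsMildSolution p f (fun t => ε • h t) (Icc θ (θ + ω)) U →
            RayleighBeam.IsMildSolution p f (fun t => ε • h t) (Icc θ (θ + ω)) V →
            U θ = V θ → EqOn U V (Icc θ (θ + ω))) ∧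
          Metric.closedBall (W θ) ρ ⊆
            (RayleighBeam.poincareMap p f (fun t => ε • h t) ω θ).Dom ∧
          ∃ U₀ ∈ Metric.closedBall (W θ) ε,
            U₀ ∈ RayleighBeam.poincareMap p f (fun t => ε • h t) ω θ U₀ ∧
            ∀ V₀ ∈ Metric.closedBall (W θ) ρ,
              V₀ ∈ RayleighBeam.poincareMap p f (fun t => ε • h t) ω θ V₀ → V₀ = U₀) ∧
        -- equivalently, the forced beam has a unique periodic solution near it
        ∃ U : ℝ → RayleighBeam.Phase,
          RayleighBeam.IsPeriodicSolution p f (fun t => ε • h t) ω U ∧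
          (∀ t, dist (U t) (W t) ≤ ε) ∧
          ∀ V : ℝ → RayleighBeam.Phase,
            RayleighBeam.IsPeriodicSolution p f (fun t => ε • h t) ω V →
            (∃ t, dist (V t) (W t) ≤ ρ) → V = U := by
  have hS := p.isC0Group_semigroup
  obtain ⟨u, hu⟩ : IsUnit (1 - p.semigroup ω) := by
    simpa [spectrum.mem_iff] using hres
  have hR₁ : (↑u⁻¹ : Phase →L[ℝ] Phase) * (1 - p.semigroup ω) = 1 := by rw [← hu, u.inv_mul]
  have hR₂ : (1 - p.semigroup ω) * (↑u⁻¹ : Phase →L[ℝ] Phase) = 1 := by rw [← hu, u.mul_inv]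
  obtain ⟨ℓ, hN, hℓ⟩ := hf.isLipschitzOnBalls hm p
  have hg : Continuous fun t => p.force (h t) := p.force.continuous.comp hh.continuous
  have hgper : Function.Periodic (fun t => p.force (h t)) ω := fun t => by simp only [hper t]
  obtain ⟨ρ, ε₀, hε₀, hρ, main⟩ := exists_periodic_near_response hS hω hR₁ hR₂ hN hℓ hg hgper
  refine ⟨ρ, ε₀, hε₀, hρ, fun ε hε hεlt => ?_⟩
  obtain ⟨U, hU, hUper, hUW, hloc⟩ := main ε hε hεlt
  have hεg : Continuous fun t => ε • p.force (h t) := hg.const_smul ε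
  have hεper : Function.Periodic (fun t => ε • p.force (h t)) ω := fun t => by simp only [hper t]
  set W := periodicResponse p.semigroup (↑u⁻¹ : Phase →L[ℝ] Phase) ω fun t => ε • p.force (h t)
  have hUsol : IsPeriodicSolution p f (fun t => ε • h t) ω U :=
    ⟨(isMildSolution_iff ..).2 hU, hUper⟩
  have huniq : ∀ (θ : ℝ) (U V : ℝ → Phase),
      IsMildSolution p f (fun t => ε • h t) (Icc θ (θ + ω)) U →
      IsMildSolution p f (fun t => ε • h t) (Icc θ (θ + ω)) V →
      U θ = V θ → EqOn U V (Icc θ (θ + ω)) := fun θ U V hU hV h0 => by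
    rw [isMildSolution_iff] at hU hV
    refine hU.eqOn hS ((hN.continuous.comp continuous_snd).add (hεg.comp continuous_fst))
      (fun R => ⟨ℓ R, fun t => LipschitzOnWith.of_dist_le_mul fun y hy z hz => ?_⟩) hV h0
    rw [dist_add_right]
    exact (hN.lipschitzOnWith R).dist_le_mul y hy z hz
  have hθ : ∀ θ : ℝ, θ + ω ∈ Icc θ (θ + ω) := fun θ => ⟨by linarith, le_rfl⟩
  -- a solution that returns to its initial value starts on the periodic solution
  have hret : ∀ (θ : ℝ) (V : ℝ → Phase),
      IsMildSolution p f (fun t => ε • h t) (Icc θ (θ + ω)) V → V θ ∈ closedBall (W θ) ρ →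
      V (θ + ω) = V θ → V θ = U θ := fun θ V hV hVρ hVr => by
    obtain ⟨V', hV', hV'θ, hV'U⟩ := hloc θ (V θ) hVρ
    refine hV'U ?_
    rw [← huniq θ V V' hV ((isMildSolution_iff ..).2 hV') hV'θ.symm (hθ θ), hVr]
  refine ⟨W, ⟨⟨(isMildSolution_zero_iff ..).2 (isMild_periodicResponse hS hR₁ hR₂ hεg hεper),
    periodic_periodicResponse _ hεper⟩, fun V hV => ?_⟩, fun θ => ⟨huniq θ, fun x hx => ?_,
    U θ, hUW θ, ?_, ?_⟩, U, hUsol, hUW, ?_⟩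
  · exact IsMild.eq_of_periodic hω.le hR₁ ((isMildSolution_zero_iff ..).1 hV.mild) hV.periodic
      (isMild_periodicResponse hS hR₁ hR₂ hεg hεper) (periodic_periodicResponse _ hεper)
  · obtain ⟨V, hV, hVθ, -⟩ := hloc θ x hx
    exact ⟨V, (isMildSolution_iff ..).2 hV, hVθ⟩
  -- The period map evaluates a chosen solution, which is `U` by uniqueness.
  · have hdom : ∃ V, IsMildSolution p f (fun t => ε • h t) (Icc θ (θ + ω)) V ∧ V θ = U θ :=
      ⟨U, hUsol.mild.mono (subset_univ _), rfl⟩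
    refine ⟨hdom, ?_⟩
    change hdom.choose (θ + ω) = U θ
    rw [huniq θ _ U hdom.choose_spec.1 (hUsol.mild.mono (subset_univ _)) hdom.choose_spec.2 (hθ θ),
      hUper]
  · rintro V₀ hV₀ ⟨hdom, hV⟩
    have hV' : hdom.choose (θ + ω) = V₀ := hV
    have h0 := hdom.choose_spec.2
    rw [← h0]
    exact hret θ _ hdom.choose_spec.1 (by rwa [h0]) (hV'.trans h0.symm)
  · rintro V hV ⟨θ, hVW⟩
    exact hV.eq_of_eqOn hω hUsol (huniq θ V U (hV.mild.mono (subset_univ _))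
      (hUsol.mild.mono (subset_univ _))
      (hret θ V (hV.mild.mono (subset_univ _)) hVW (hV.periodic θ)))
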